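/- **Theorem (regret of SCRIBLE).** Let $n\ge 1$ and $\nu\ge 0$. There are constants $c,C>0$, depending only on $n$ and $\nu$, such that the following holds. Let $\mathcal K\subset\mathbb R^n$ be a compact convex set with nonempty interior, and let $\mathcal R:\operatorname{int}\mathcal K\to\mathbb R$ be a $\nu$-self-concordant barrier for $\mathcal K$, that is: $\mathcal R$ is convex and three times continuously differentiable, it tends to $+\infty$ along every sequence in $\operatorname{int}\mathcal K$ approaching the boundary of $\mathcal K$, and for all $x\in\operatorname{int}\mathcal K$, $h\in\mathbb R^n$, $$|\nabla^3\mathcal R(x)[h,h,h]|\le 2\left(\nabla^2\mathcal R(x)[h,h]\right)^{3/2},\qquad |\nabla\mathcal R(x)[h]|\le \nu^{1/2}\left(\nabla^2\mathcal R(x)[h,h]\right)^{1/2}.$$ Assume that $\nabla^2\mathcal R(x)$ has full rank for every $x\in\operatorname{int}\mathcal K$. Let $T\ge 2$, and let $f_1,\dots,f_T$ be linear functions on $\mathbb R^n$, fixed in advance, with $|f_t(x)|\le 1$ for all $x\in\mathcal K$ and all $t$. Run the SCRIBLE algorithm with step size $\eta=c/\sqrt T$: let $x_1\in\operatorname{int}\mathcal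 K$ be the point with $\nabla\mathcal R(x_1)=0$; for $t=1,\dots,T$, put $A_t=[\nabla^2\mathcal R(x_t)]^{-1/2}$, draw $u_t$ uniformly from the Euclidean unit sphere, independently of the earlier draws, play $y_t=x_t+A_tu_t$, observe the loss $f_t(y_t)$, put $g_t=n\,f_t(y_t)\,A_t^{-1}u_t$, and update $$x_{t+1}=\operatorname*{argmin}_{x\in\operatorname{int}\mathcal K}\Big\{\eta\sum_{\tau=1}^t g_\tau^\top x+\mathcal R(x)\Big\}.$$ Then all $y_t$ lie in $\mathcal K$, the random variables $f_t(y_t)$ are integrable, and $$\sum_{t=1}^T\mathbb E[f_t(y_t)]-\min_{x\in\mathcal K}\sum_{t=1}^T f_t(x)\le C\sqrt T\,\log T .$$ -/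

import Mathlib

open MeasureTheory ProbabilityTheory Filter Topology

noncomputable section

/-- The uniform probability distribution on the Euclidean unit sphere of `ℝⁿ`: the normalized
surface measure. -/
def sphereUniform (n : ℕ) : Measure (Metric.sphere (0 : EuclideanSpace ℝ (Fin n)) 1) :=
  ((volume : Measure (EuclideanSpace ℝ (Fin n))).toSphere Set.univ)⁻¹ •
    (volume : Measure (EuclideanSpace ℝ (Fin n))).toSphere

/-- The Hessian matrix `∇²R(x)` in the standard basis. -/
def hessian {n : ℕ} (R : EuclideanSpace ℝ (Fin n) → ℝ) (x : EuclideanSpace ℝ (Fin n)) :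
    Matrix (Fin n) (Fin n) ℝ :=
  Matrix.of fun i j =>
    iteratedFDeriv ℝ 2 R x ![EuclideanSpace.single i 1, EuclideanSpace.single j 1]

/-- `R` is a `ν`-self-concordant barrier for `K`. The function is defined on `int K`; its values
elsewhere are never used. -/
structure IsSelfConcordantBarrier {n : ℕ} (K : Set (EuclideanSpace ℝ (Fin n))) (ν : ℝ)
    (R : EuclideanSpace ℝ (Fin n) → ℝ) : Prop where
  contDiffOn : ContDiffOn ℝ 3 R (interior K)
  convexOn : ConvexOn ℝ (interior K) R
  tendsto_atTop : ∀ z ∈ frontier K, Tendsto R (𝓝[interior K] z) atTop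
  third_le : ∀ x ∈ interior K, ∀ h : EuclideanSpace ℝ (Fin n),
    |iteratedFDeriv ℝ 3 R x (fun _ => h)| ≤
      2 * (iteratedFDeriv ℝ 2 R x (fun _ => h)) ^ (3 / 2 : ℝ)
  grad_le : ∀ x ∈ interior K, ∀ h : EuclideanSpace ℝ (Fin n),
    |fderiv ℝ R x h| ≤ ν ^ (1 / 2 : ℝ) * (iteratedFDeriv ℝ 2 R x (fun _ => h)) ^ (1 / 2 : ℝ)

namespace Scrible

variable {n : ℕ}

open scoped MatrixOrder in
/-- `A = [∇²R(x)]^{-1/2}`. -/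
def dikinMatrix (R : EuclideanSpace ℝ (Fin n) → ℝ) (x : EuclideanSpace ℝ (Fin n)) :
    Matrix (Fin n) (Fin n) ℝ :=
  CFC.sqrt (hessian R x)⁻¹

/-- The point `y = x + A u` on the boundary of the Dikin ellipsoid of `x`. -/
def play (R : EuclideanSpace ℝ (Fin n) → ℝ) (x u : EuclideanSpace ℝ (Fin n)) :
    EuclideanSpace ℝ (Fin n) :=
  x + Matrix.toEuclideanLin (dikinMatrix R x) u

/-- The ellipsoidal gradient estimator `g = n · f(y) · A⁻¹ u`, where `v = f(y)` is the observed
loss. -/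
def estimate (R : EuclideanSpace ℝ (Fin n) → ℝ) (x u : EuclideanSpace ℝ (Fin n)) (v : ℝ) :
    EuclideanSpace ℝ (Fin n) :=
  ((n : ℝ) * v) • Matrix.toEuclideanLin (dikinMatrix R x)⁻¹ u

/-- A stationary point of `R` in `int K`. -/
def start (K : Set (EuclideanSpace ℝ (Fin n))) (R : EuclideanSpace ℝ (Fin n) → ℝ) :
    EuclideanSpace ℝ (Fin n) :=
  Classical.epsilon fun x => x ∈ interior K ∧ fderiv ℝ R x = 0

/-- The follow-the-regularized-leader update `argmin_x {η ⟪G, x⟫ + R(x)}`, taken over the domain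
`int K` of the barrier. -/
def rftl (K : Set (EuclideanSpace ℝ (Fin n))) (R : EuclideanSpace ℝ (Fin n) → ℝ) (η : ℝ)
    (G : EuclideanSpace ℝ (Fin n)) : EuclideanSpace ℝ (Fin n) :=
  Classical.epsilon fun x =>
    x ∈ interior K ∧ IsMinOn (fun z => η * inner ℝ G z + R z) (interior K) x

/-- The state `(x, G)` of the algorithm at the beginning of a round: the current point and the sum
of the gradient estimates of the previous rounds, for the costs `f` and the sampled unit
vectors `u`. Rounds are numbered from `0`. In each round, `f` is evaluated at the played point
only. -/
def state (K : Set (EuclideanSpace ℝ (Fin n))) (R : EuclideanSpace ℝ (Fin n) → ℝ) (η : ℝ)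
    (f : ℕ → EuclideanSpace ℝ (Fin n) → ℝ) (u : ℕ → EuclideanSpace ℝ (Fin n)) :
    ℕ → EuclideanSpace ℝ (Fin n) × EuclideanSpace ℝ (Fin n)
  | 0 => (start K R, 0)
  | t + 1 =>
    let x := (state K R η f u t).1
    let G := (state K R η f u t).2 + estimate R x (u t) (f t (play R x (u t)))
    (rftl K R η G, G)

/-- The point `y_t` played by the algorithm in round `t`. -/
def action (K : Set (EuclideanSpace ℝ (Fin n))) (R : EuclideanSpace ℝ (Fin n) → ℝ) (η : ℝ)
    (f : ℕ → EuclideanSpace ℝ (Fin n) → ℝ) (u : ℕ → EuclideanSpace ℝ (Fin n)) (t : ℕ) :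
    EuclideanSpace ℝ (Fin n) :=
  play R (state K R η f u t).1 (u t)

end Scrible

/-- `∑ₜ E[fₜ(yₜ)] - min_{x ∈ K} ∑ₜ fₜ(x)` over the rounds `t < T`, for random plays `y`. -/
def expectedRegret {n : ℕ} {Ω : Type*} [MeasurableSpace Ω] (P : Measure Ω)
    (K : Set (EuclideanSpace ℝ (Fin n))) (f : ℕ → EuclideanSpace ℝ (Fin n) → ℝ)
    (y : ℕ → Ω → EuclideanSpace ℝ (Fin n)) (T : ℕ) : ℝ :=
  (∑ t ∈ Finset.range T, (∫ ω, f t (y t ω) ∂P)) -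
    sInf ((fun x => ∑ t ∈ Finset.range T, f t x) '' K)

end

/-! The sphere law has mean zero and covariance `I / n`, so, given the past, `f_t(y_t) - f_t(w)` and
`⟪g_t, x_t - w⟫` have the same expectation (`integral_loss_sub_inner_estimate`). The expected regret
against an interior `w` is thus the expectation of `∑ ⟪g_t, x_t - w⟫`, which is bounded for every
outcome of the draws.

By the be-the-leader induction, this sum is at most `∑ ⟪g_t, x_t - x_{t+1}⟫ + (R w - R x₁) / η`
(`sum_inner_grad_next_le`). The dual local norm of `g_t` is at most `n`, and self-concordance makes
`R` strongly convex enough in the local norm that `x_{t+1}` is within `2ηn` of `x_t`. Each stability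
term is therefore at most `2ηn²`, however large `g_t` is in Euclidean norm
(`inner_grad_sub_next_le`).

The barrier term is infinite on the boundary, so a comparator `z` is first pulled towards `x₁` by
the factor `1 - 1/T`. This costs at most 2 in total loss and leaves a barrier gap of at most `(ν +
1) log T` (`barrier_sub_le`). With `η` of order `1/√T` the total is of order `√T log T`.

Self-concordance enters through one fact: along a line of direction `h`, the inverse local norm of
`h` is 1-Lipschitz. It also places the Dikin ellipsoid, hence every play, in `K`. Integrability
holds because each iterate depends continuously on the earlier draws, which range over a compact
space. -/

theorem hasDerivAt_iteratedFDeriv_line {E : Type*} [NormedAddCommGroup E] [NormedSpace ℝ E]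
    {R : E → ℝ} {N k : ℕ} {x h : E} {t : ℝ} (hR : ContDiffAt ℝ N R (x + t • h)) (hk : k < N) :
    HasDerivAt (fun s : ℝ => iteratedFDeriv ℝ k R (x + s • h) (fun _ => h))
      (iteratedFDeriv ℝ (k + 1) R (x + t • h) (fun _ => h)) t := by
  have h1 : DifferentiableAt ℝ (iteratedFDeriv ℝ k R) (x + t • h) :=
    hR.differentiableAt_iteratedFDeriv (by exact_mod_cast hk)
  have h2 : HasDerivAt (fun s : ℝ => x + s • h) h t := by
    simpa using ((hasDerivAt_id t).smul_const h).const_add x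
  have h3 := h1.hasFDerivAt.comp_hasDerivAt t h2
  have h4 := (ContinuousMultilinearMap.apply ℝ (fun _ : Fin k => E) ℝ
    (fun _ => h)).hasFDerivAt.comp_hasDerivAt t h3
  rw [iteratedFDeriv_succ_apply_left]
  exact h4

/-! ### The Hessian matrix, its inverse square root, and their continuity -/

section Hessian

variable {n : ℕ}

theorem hessian_apply (R : EuclideanSpace ℝ (Fin n) → ℝ) (x : EuclideanSpace ℝ (Fin n))
    (i j : Fin n) : hessian R x i j = fderiv ℝ (fderiv ℝ R) x (EuclideanSpace.single i 1)
      (EuclideanSpace.single j 1) := by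
  simp [hessian, iteratedFDeriv_two_apply]

theorem iteratedFDeriv_two_eq_inner_hessian (R : EuclideanSpace ℝ (Fin n) → ℝ)
    (x h : EuclideanSpace ℝ (Fin n)) :
    iteratedFDeriv ℝ 2 R x (fun _ => h) = inner ℝ h (Matrix.toEuclideanLin (hessian R x) h) := by
  have hh : h = ∑ i, h i • EuclideanSpace.single i (1 : ℝ) := by
    ext j; simp [Finset.sum_apply, Pi.single_apply]
  rw [iteratedFDeriv_two_apply]
  conv_lhs => rw [hh]
  simp only [map_sum, map_smul, FunLike.coe_sum, FunLike.coe_smul, Finset.sum_apply, Pi.smul_apply]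
  simp only [PiLp.inner_apply, Matrix.toLpLin_apply, Matrix.mulVec, dotProduct, hessian_apply]
  simp only [smul_eq_mul, Finset.mul_sum]
  rw [Finset.sum_comm]
  refine Finset.sum_congr rfl fun i _ => ?_
  simp [Finset.mul_sum, mul_comm, mul_left_comm]

theorem hessian_isHermitian {R : EuclideanSpace ℝ (Fin n) → ℝ} {x : EuclideanSpace ℝ (Fin n)}
    (hR : ContDiffAt ℝ 3 R x) : (hessian R x).IsHermitian := by
  have := (hR.isSymmSndFDerivAt (by simp; norm_num)).eq
  ext i j
  simp [hessian_apply, this (EuclideanSpace.single j 1)]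

/-- On a line, the derivative of a convex function is monotone, so its own derivative is
nonnegative. -/
theorem iteratedFDeriv_two_nonneg_of_convexOn {E : Type*} [NormedAddCommGroup E] [NormedSpace ℝ E]
    {R : E → ℝ} {U : Set E} (hU : IsOpen U) (hc : ConvexOn ℝ U R) (hR : ContDiffOn ℝ 3 R U)
    {x : E} (hx : x ∈ U) (h : E) : 0 ≤ iteratedFDeriv ℝ 2 R x (fun _ => h) := by
  have hcont : Continuous fun s : ℝ => x + s • h := by fun_prop
  set S : Set ℝ := (fun s : ℝ => x + s • h) ⁻¹' U
  have hS : IsOpen S := hU.preimage hcont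
  have h0 : (0 : ℝ) ∈ S := by simpa [S] using hx
  have hA : ∀ s ∈ S, ContDiffAt ℝ 3 R (x + s • h) := fun s hs => hR.contDiffAt (hU.mem_nhds hs)
  have hd : ∀ s ∈ S, HasDerivAt (fun s : ℝ => R (x + s • h))
      (iteratedFDeriv ℝ 1 R (x + s • h) (fun _ => h)) s := fun s hs => by
    simpa using hasDerivAt_iteratedFDeriv_line (N := 3) (k := 0) (hA s hs) (by norm_num)
  have hd2 : HasDerivAt (fun s : ℝ => iteratedFDeriv ℝ 1 R (x + s • h) (fun _ => h))
      (iteratedFDeriv ℝ 2 R x (fun _ => h)) 0 := by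
    simpa using hasDerivAt_iteratedFDeriv_line (N := 3) (k := 1) (hA 0 h0) (by norm_num)
  have hconv : ConvexOn ℝ S (fun s : ℝ => R (x + s • h)) := by
    have := hc.comp_affineMap (AffineMap.lineMap x (x + h))
    have e : ∀ s : ℝ, AffineMap.lineMap x (x + h) s = x + s • h := by
      intro s; simp [AffineMap.lineMap_apply, add_comm]
    have e2 : (⇑(AffineMap.lineMap x (x + h) : ℝ →ᵃ[ℝ] E)) = fun s : ℝ => x + s • h := funext e
    rw [e2] at this
    exact this
  have hmono : MonotoneOn (deriv fun s : ℝ => R (x + s • h)) S :=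
    hconv.monotoneOn_deriv fun s hs => (hd s hs).differentiableAt
  have hmono' : MonotoneOn (fun s : ℝ => iteratedFDeriv ℝ 1 R (x + s • h) (fun _ => h)) S :=
    hmono.congr fun s hs => (hd s hs).deriv
  have hw := (hd2.hasDerivWithinAt (s := S)).derivWithin (hS.uniqueDiffWithinAt h0)
  rw [← hw]
  exact hmono'.derivWithin_nonneg

theorem hessian_posDef {R : EuclideanSpace ℝ (Fin n) → ℝ} {U : Set (EuclideanSpace ℝ (Fin n))}
    (hU : IsOpen U) (hc : ConvexOn ℝ U R) (hR : ContDiffOn ℝ 3 R U)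
    {x : EuclideanSpace ℝ (Fin n)} (hx : x ∈ U) (hrank : (hessian R x).rank = n) :
    (hessian R x).PosDef := by
  have hs : (hessian R x).PosSemidef := by
    refine Matrix.PosSemidef.of_dotProduct_mulVec_nonneg
      (hessian_isHermitian (hR.contDiffAt (hU.mem_nhds hx))) fun v => ?_
    have := iteratedFDeriv_two_nonneg_of_convexOn hU hc hR hx (WithLp.toLp 2 v)
    rw [iteratedFDeriv_two_eq_inner_hessian] at this
    simpa [PiLp.inner_apply, dotProduct, Matrix.toLpLin_apply, mul_comm] using this
  rw [hs.posDef_iff_isUnit]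
  rw [← Matrix.mulVec_surjective_iff_isUnit, ← Matrix.coe_mulVecLin, ← LinearMap.range_eq_top]
  exact Submodule.eq_top_of_finrank_eq (by simpa [Matrix.rank] using hrank)


namespace Scrible

open scoped MatrixOrder

variable {R : EuclideanSpace ℝ (Fin n) → ℝ} {x : EuclideanSpace ℝ (Fin n)}

theorem dikinMatrix_posSemidef (R : EuclideanSpace ℝ (Fin n) → ℝ) (x : EuclideanSpace ℝ (Fin n)) :
    (dikinMatrix R x).PosSemidef :=
  Matrix.nonneg_iff_posSemidef.1 (CFC.sqrt_nonneg _)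

theorem dikinMatrix_mul_self (hH : (hessian R x).PosDef) :
    dikinMatrix R x * dikinMatrix R x = (hessian R x)⁻¹ :=
  CFC.sqrt_mul_sqrt_self _ (Matrix.nonneg_iff_posSemidef.2 hH.inv.posSemidef)

theorem isUnit_det_dikinMatrix (hH : (hessian R x).PosDef) : IsUnit (dikinMatrix R x).det := by
  have h := (Matrix.isUnit_iff_isUnit_det _).1 hH.inv.isUnit
  rw [← dikinMatrix_mul_self hH, Matrix.det_mul] at h
  exact isUnit_of_mul_isUnit_left h

theorem inv_dikinMatrix_mul_self (hH : (hessian R x).PosDef) :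
    (dikinMatrix R x)⁻¹ * (dikinMatrix R x)⁻¹ = hessian R x := by
  rw [← Matrix.mul_inv_rev, dikinMatrix_mul_self hH,
    Matrix.nonsing_inv_nonsing_inv _ ((Matrix.isUnit_iff_isUnit_det _).1 hH.isUnit)]

theorem dikinMatrix_apply_inv_apply (hH : (hessian R x).PosDef) (v : EuclideanSpace ℝ (Fin n)) :
    Matrix.toEuclideanLin (dikinMatrix R x) (Matrix.toEuclideanLin (dikinMatrix R x)⁻¹ v) = v := by
  simp [Matrix.toLpLin_apply, Matrix.mul_nonsing_inv _ (isUnit_det_dikinMatrix hH)]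

theorem inner_toEuclideanLin_comm {M : Matrix (Fin n) (Fin n) ℝ} (hM : M.IsHermitian)
    (v w : EuclideanSpace ℝ (Fin n)) :
    inner ℝ (Matrix.toEuclideanLin M v) w = inner ℝ v (Matrix.toEuclideanLin M w) :=
  Matrix.isSymmetric_toEuclideanLin_iff.2 hM v w

theorem dikinMatrix_isHermitian (R : EuclideanSpace ℝ (Fin n) → ℝ)
    (x : EuclideanSpace ℝ (Fin n)) : (dikinMatrix R x).IsHermitian :=
  (dikinMatrix_posSemidef R x).isHermitian

theorem norm_sq_inv_dikinMatrix_apply (hH : (hessian R x).PosDef)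
    (h : EuclideanSpace ℝ (Fin n)) :
    ‖Matrix.toEuclideanLin (dikinMatrix R x)⁻¹ h‖ ^ 2 = iteratedFDeriv ℝ 2 R x (fun _ => h) := by
  rw [iteratedFDeriv_two_eq_inner_hessian, ← inv_dikinMatrix_mul_self hH,
    ← real_inner_self_eq_norm_sq, inner_toEuclideanLin_comm (dikinMatrix_isHermitian R x).inv]
  simp [Matrix.toLpLin_apply]

theorem continuousOn_hessian {U : Set (EuclideanSpace ℝ (Fin n))} (hU : IsOpen U)
    (hR : ContDiffOn ℝ 3 R U) : ContinuousOn (hessian R) U := by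
  refine continuousOn_pi.2 fun i => continuousOn_pi.2 fun j => ?_
  have h1 : ContinuousOn (iteratedFDeriv ℝ 2 R) U := fun y hy =>
    (((hR.contDiffAt (hU.mem_nhds hy)).differentiableAt_iteratedFDeriv
      (by norm_num)).continuousAt).continuousWithinAt
  exact (ContinuousMultilinearMap.apply ℝ (fun _ : Fin 2 => EuclideanSpace ℝ (Fin n)) ℝ
    ![EuclideanSpace.single i 1, EuclideanSpace.single j 1]).continuous.comp_continuousOn h1

theorem isClosed_posSemidef : IsClosed {M : Matrix (Fin n) (Fin n) ℝ | M.PosSemidef} := by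
  have : {M : Matrix (Fin n) (Fin n) ℝ | M.PosSemidef} =
      {M | M.conjTranspose = M} ∩ ⋂ v : Fin n → ℝ, {M | 0 ≤ v ⬝ᵥ M.mulVec v} := by
    ext M
    simp only [Set.mem_ofPred_eq, Set.mem_inter_iff, Set.mem_iInter]
    exact ⟨fun h => ⟨h.isHermitian, fun v => by simpa using h.dotProduct_mulVec_nonneg v⟩,
      fun h => .of_dotProduct_mulVec_nonneg h.1 fun v => by simpa using h.2 v⟩
  rw [this]
  refine (isClosed_eq (by fun_prop) continuous_id).inter (isClosed_iInter fun v => ?_)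
  exact isClosed_le continuous_const (by fun_prop)

theorem sq_apply_le_trace_mul_self {M : Matrix (Fin n) (Fin n) ℝ} (hM : M.IsHermitian)
    (i j : Fin n) : (M i j) ^ 2 ≤ (M * M).trace := by
  have h1 : (M * M).trace = ∑ a, ∑ b, (M a b) ^ 2 := by
    simp only [Matrix.trace, Matrix.diag, Matrix.mul_apply]
    refine Finset.sum_congr rfl fun a _ => Finset.sum_congr rfl fun b _ => ?_
    have : M b a = M a b := by simpa using hM.apply a b
    rw [this, sq]
  rw [h1]
  exact (Finset.single_le_sum (f := fun b => (M i b) ^ 2) (fun b _ => sq_nonneg _)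
    (Finset.mem_univ j)).trans (Finset.single_le_sum (f := fun a => ∑ b, (M a b) ^ 2)
    (fun a _ => Finset.sum_nonneg fun b _ => sq_nonneg _) (Finset.mem_univ i))

/-- Compactness and uniqueness: near `M₀` the trace bounds all entries of the square roots, and any
cluster point is positive semidefinite with square `M₀`, hence is the square root of `M₀`. -/
theorem continuousOn_matrix_sqrt :
    ContinuousOn (CFC.sqrt : Matrix (Fin n) (Fin n) ℝ → _) {M | M.PosSemidef} := by
  intro M₀ hM₀
  obtain ⟨B, hB⟩ : ∃ B : ℝ, M₀.trace < B := ⟨_, lt_add_one _⟩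
  have hs : IsCompact (Set.univ.pi fun _ : Fin n => Set.univ.pi fun _ : Fin n =>
      Set.Icc (-√B) (√B)) :=
    isCompact_univ_pi fun _ => isCompact_univ_pi fun _ => isCompact_Icc
  refine IsCompact.tendsto_nhds_of_unique_mapClusterPt hs ?_ ?_
  · have h1 : ∀ᶠ M : Matrix (Fin n) (Fin n) ℝ in 𝓝[{M | M.PosSemidef}] M₀, M.trace < B :=
      (continuous_id.matrix_trace.tendsto M₀).mono_left nhdsWithin_le_nhds |>.eventually_lt_const hB
    filter_upwards [h1, self_mem_nhdsWithin] with M hMB hM i _ j _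
    have hle := sq_apply_le_trace_mul_self
      (Matrix.nonneg_iff_posSemidef.1 (CFC.sqrt_nonneg M)).isHermitian i j
    rw [CFC.sqrt_mul_sqrt_self M (Matrix.nonneg_iff_posSemidef.2 hM)] at hle
    exact abs_le.1 (Real.abs_le_sqrt (hle.trans hMB.le))
  · intro N _ hN
    obtain ⟨V, hV, hVN⟩ := mapClusterPt_iff_ultrafilter.1 hN
    have hVset : ∀ᶠ M in (V : Filter (Matrix (Fin n) (Fin n) ℝ)), M.PosSemidef :=
      hV self_mem_nhdsWithin
    have hN0 : N.PosSemidef := isClosed_posSemidef.mem_of_tendsto hVN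
      (Eventually.of_forall fun M => Matrix.nonneg_iff_posSemidef.1 (CFC.sqrt_nonneg M))
    have hsq : Tendsto (fun M : Matrix (Fin n) (Fin n) ℝ => CFC.sqrt M * CFC.sqrt M) V
        (𝓝 (N * N)) := hVN.mul hVN
    have hid : Tendsto (fun M : Matrix (Fin n) (Fin n) ℝ => CFC.sqrt M * CFC.sqrt M) V (𝓝 M₀) := by
      refine Tendsto.congr' ?_ (hV.trans nhdsWithin_le_nhds : Tendsto id _ _)
      filter_upwards [hVset] with M hM
      exact (CFC.sqrt_mul_sqrt_self M (Matrix.nonneg_iff_posSemidef.2 hM)).symm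
    exact (CFC.sqrt_unique (tendsto_nhds_unique hsq hid)
      (Matrix.nonneg_iff_posSemidef.2 hN0)).symm

theorem continuousAt_matrix_inv_of_isUnit_det {M : Matrix (Fin n) (Fin n) ℝ} (hM : IsUnit M.det) :
    ContinuousAt Inv.inv M := by
  refine continuousAt_matrix_inv M ?_
  rw [Ring.inverse_eq_inv']
  exact continuousAt_inv₀ hM.ne_zero

theorem continuousOn_dikinMatrix {U : Set (EuclideanSpace ℝ (Fin n))} (hU : IsOpen U)
    (hR : ContDiffOn ℝ 3 R U) (hH : ∀ y ∈ U, (hessian R y).PosDef) :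
    ContinuousOn (dikinMatrix R) U := by
  refine continuousOn_matrix_sqrt.comp (fun y hy => ?_) fun y hy => (hH y hy).inv.posSemidef
  exact (continuousAt_matrix_inv_of_isUnit_det
    ((Matrix.isUnit_iff_isUnit_det _).1 (hH y hy).isUnit)).comp_continuousWithinAt
    (continuousOn_hessian hU hR y hy)

theorem continuousOn_inv_dikinMatrix {U : Set (EuclideanSpace ℝ (Fin n))} (hU : IsOpen U)
    (hR : ContDiffOn ℝ 3 R U) (hH : ∀ y ∈ U, (hessian R y).PosDef) :
    ContinuousOn (fun y => (dikinMatrix R y)⁻¹) U := fun y hy =>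
  (continuousAt_matrix_inv_of_isUnit_det (isUnit_det_dikinMatrix (hH y hy))).comp_continuousWithinAt
    (continuousOn_dikinMatrix hU hR hH y hy)

end Scrible

end Hessian

/-! ### Self-concordance: local norms along segments, the Dikin ellipsoid, growth of the barrier -/

/-- The derivative of `q^(-1/2)` is `-q' / (2 q^(3/2))`, of absolute value at most 1 by the
self-concordance inequality. -/
theorem abs_inv_sqrt_sub_inv_sqrt_le {q q' : ℝ → ℝ} {b : ℝ} (hb : 0 ≤ b)
    (hq : ∀ t ∈ Set.Icc 0 b, HasDerivAt q (q' t) t) (hpos : ∀ t ∈ Set.Icc 0 b, 0 < q t)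
    (hbd : ∀ t ∈ Set.Icc 0 b, |q' t| ≤ 2 * q t ^ (3 / 2 : ℝ)) :
    |(√(q b))⁻¹ - (√(q 0))⁻¹| ≤ b := by
  have key := Convex.norm_image_sub_le_of_norm_hasDerivWithin_le (C := 1) (s := Set.Icc 0 b)
    (f := fun t => (√(q t))⁻¹) (f' := fun t => -(q' t / (2 * √(q t))) / (√(q t)) ^ 2)
    (x := 0) (y := b)
    (fun t ht => (((hq t ht).sqrt (hpos t ht).ne').inv
      (Real.sqrt_pos.2 (hpos t ht)).ne').hasDerivWithinAt)
    (fun t ht => ?_) (convex_Icc 0 b) ⟨le_rfl, hb⟩ ⟨hb, le_rfl⟩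
  · simpa [abs_of_nonneg hb] using key
  · have hs := Real.sqrt_pos.2 (hpos t ht)
    have h1 := hbd t ht
    have h2 : q t ^ (3 / 2 : ℝ) = √(q t) ^ 3 := by
      rw [Real.sqrt_eq_rpow, ← Real.rpow_natCast, ← Real.rpow_mul (hpos t ht).le]; norm_num
    rw [h2] at h1
    rw [Real.norm_eq_abs, abs_div, abs_neg, abs_div, abs_of_pos (by positivity : 0 < 2 * √(q t)),
      abs_of_pos (by positivity : 0 < √(q t) ^ 2), div_div, div_le_one (by positivity)]
    linarith [h1, show 2 * √(q t) * √(q t) ^ 2 = 2 * √(q t) ^ 3 by ring]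

namespace Scrible

variable {n : ℕ} {K : Set (EuclideanSpace ℝ (Fin n))} {ν : ℝ}
  {R : EuclideanSpace ℝ (Fin n) → ℝ}

/-- The norm `‖h‖ₓ = √(∇²R(x)[h, h])`. -/
noncomputable def localNorm {n : ℕ} (R : EuclideanSpace ℝ (Fin n) → ℝ)
    (x h : EuclideanSpace ℝ (Fin n)) : ℝ :=
  ‖Matrix.toEuclideanLin (dikinMatrix R x)⁻¹ h‖

theorem localNorm_nonneg (x h : EuclideanSpace ℝ (Fin n)) : 0 ≤ localNorm R x h := norm_nonneg _

theorem iteratedFDeriv_two_eq_localNorm_sq {x : EuclideanSpace ℝ (Fin n)}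
    (hH : (hessian R x).PosDef) (h : EuclideanSpace ℝ (Fin n)) :
    iteratedFDeriv ℝ 2 R x (fun _ => h) = localNorm R x h ^ 2 :=
  (norm_sq_inv_dikinMatrix_apply hH h).symm

theorem sqrt_iteratedFDeriv_two {x : EuclideanSpace ℝ (Fin n)}
    (hH : (hessian R x).PosDef) (h : EuclideanSpace ℝ (Fin n)) :
    √(iteratedFDeriv ℝ 2 R x (fun _ => h)) = localNorm R x h := by
  rw [iteratedFDeriv_two_eq_localNorm_sq hH, Real.sqrt_sq (localNorm_nonneg x h)]

theorem localNorm_pos {x h : EuclideanSpace ℝ (Fin n)} (hH : (hessian R x).PosDef) (hh : h ≠ 0) :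
    0 < localNorm R x h := by
  refine norm_pos_iff.2 fun h0 => hh ?_
  rw [← dikinMatrix_apply_inv_apply hH h, h0, map_zero]

theorem localNorm_smul (x h : EuclideanSpace ℝ (Fin n)) {t : ℝ} (ht : 0 ≤ t) :
    localNorm R x (t • h) = t * localNorm R x h := by
  simp [localNorm, norm_smul, abs_of_nonneg ht]

variable (hB : IsSelfConcordantBarrier K ν R) (hH : ∀ x ∈ interior K, (hessian R x).PosDef)

include hB

theorem hasDerivAt_line_zero {x h : EuclideanSpace ℝ (Fin n)} {t : ℝ}
    (hx : x + t • h ∈ interior K) :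
    HasDerivAt (fun s : ℝ => R (x + s • h)) (fderiv ℝ R (x + t • h) h) t := by
  simpa using hasDerivAt_iteratedFDeriv_line (N := 3) (k := 0)
    (hB.contDiffOn.contDiffAt (isOpen_interior.mem_nhds hx)) (by norm_num)

theorem hasDerivAt_line_one {x h : EuclideanSpace ℝ (Fin n)} {t : ℝ}
    (hx : x + t • h ∈ interior K) :
    HasDerivAt (fun s : ℝ => fderiv ℝ R (x + s • h) h)
      (iteratedFDeriv ℝ 2 R (x + t • h) (fun _ => h)) t := by
  simpa using hasDerivAt_iteratedFDeriv_line (N := 3) (k := 1)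
    (hB.contDiffOn.contDiffAt (isOpen_interior.mem_nhds hx)) (by norm_num)

theorem hasDerivAt_line_two {x h : EuclideanSpace ℝ (Fin n)} {t : ℝ}
    (hx : x + t • h ∈ interior K) :
    HasDerivAt (fun s : ℝ => iteratedFDeriv ℝ 2 R (x + s • h) (fun _ => h))
      (iteratedFDeriv ℝ 3 R (x + t • h) (fun _ => h)) t :=
  hasDerivAt_iteratedFDeriv_line (N := 3) (k := 2)
    (hB.contDiffOn.contDiffAt (isOpen_interior.mem_nhds hx)) (by norm_num)

include hH

theorem abs_inv_localNorm_sub_le {x h : EuclideanSpace ℝ (Fin n)} (hh : h ≠ 0) {b : ℝ}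
    (hb : 0 ≤ b) (hseg : ∀ t ∈ Set.Icc 0 b, x + t • h ∈ interior K) :
    |(localNorm R (x + b • h) h)⁻¹ - (localNorm R x h)⁻¹| ≤ b := by
  have := abs_inv_sqrt_sub_inv_sqrt_le hb (fun t ht => hasDerivAt_line_two hB (hseg t ht))
    (fun t ht => by
      rw [iteratedFDeriv_two_eq_localNorm_sq (hH _ (hseg t ht))]
      exact pow_pos (localNorm_pos (hH _ (hseg t ht)) hh) 2)
    (fun t ht => hB.third_le _ (hseg t ht) h)
  rw [sqrt_iteratedFDeriv_two (hH _ (hseg b ⟨hb, le_rfl⟩)),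
    sqrt_iteratedFDeriv_two (hH _ (hseg 0 ⟨le_rfl, hb⟩))] at this
  simpa using this

theorem localNorm_line_le {x h : EuclideanSpace ℝ (Fin n)} {b : ℝ}
    (hb : 0 ≤ b) (hseg : ∀ t ∈ Set.Icc 0 b, x + t • h ∈ interior K)
    (hr : localNorm R x h * b < 1) :
    localNorm R (x + b • h) h ≤ localNorm R x h / (1 - localNorm R x h * b) := by
  rcases eq_or_ne h 0 with rfl | hh
  · simp [localNorm]
  have h1 := abs_le.1 (abs_inv_localNorm_sub_le hB hH hh hb hseg)
  have hx := hseg 0 ⟨le_rfl, hb⟩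
  rw [zero_smul, add_zero] at hx
  have hp := localNorm_pos (hH _ hx) hh
  have hp' := localNorm_pos (hH _ (hseg b ⟨hb, le_rfl⟩)) hh
  have h2 : (1 - localNorm R x h * b) / localNorm R x h ≤ (localNorm R (x + b • h) h)⁻¹ := by
    rw [sub_div, mul_div_cancel_left₀ _ hp.ne', one_div]; linarith [h1.1]
  have h3 := inv_anti₀ (div_pos (by linarith) hp) h2
  simpa using h3

theorem div_le_localNorm_line {x h : EuclideanSpace ℝ (Fin n)} {b : ℝ}
    (hb : 0 ≤ b) (hseg : ∀ t ∈ Set.Icc 0 b, x + t • h ∈ interior K) :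
    localNorm R x h / (1 + localNorm R x h * b) ≤ localNorm R (x + b • h) h := by
  rcases eq_or_ne h 0 with rfl | hh
  · simp [localNorm]
  have h1 := abs_le.1 (abs_inv_localNorm_sub_le hB hH hh hb hseg)
  have hx := hseg 0 ⟨le_rfl, hb⟩
  rw [zero_smul, add_zero] at hx
  have hp := localNorm_pos (hH _ hx) hh
  have hp' := localNorm_pos (hH _ (hseg b ⟨hb, le_rfl⟩)) hh
  have h2 : (localNorm R (x + b • h) h)⁻¹ ≤ (1 + localNorm R x h * b) / localNorm R x h := by
    rw [add_div, mul_div_cancel_left₀ _ hp.ne', one_div]; linarith [h1.2]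
  have h3 := inv_anti₀ (inv_pos.2 hp') h2
  simpa using h3

/-- The open Dikin ellipsoid of an interior point lies in the interior. -/
theorem add_mem_interior_of_localNorm_lt_one {x h : EuclideanSpace ℝ (Fin n)}
    (hx : x ∈ interior K) (hr : localNorm R x h < 1) : x + h ∈ interior K := by
  by_contra hnot
  -- `S` collects the times at which the segment is outside the interior; its infimum `τ` is the
  -- first exit. Before `τ` the local norm of `h` is at most `r / (1 - r)`, so the second derivative
  -- of `R` along the segment is bounded. Integrating twice bounds `R` there, against its blow-up at
  -- the frontier.
  set S : Set ℝ := Set.Icc 0 1 ∩ (fun t : ℝ => x + t • h) ⁻¹' (interior K)ᶜ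
  have hcont : Continuous fun t : ℝ => x + t • h := by fun_prop
  have hS : IsClosed S := isClosed_Icc.inter (isOpen_interior.isClosed_compl.preimage hcont)
  have hSne : S.Nonempty := ⟨1, ⟨zero_le_one, le_rfl⟩, by simpa using hnot⟩
  have hSb : BddBelow S := ⟨0, fun t ht => ht.1.1⟩
  obtain ⟨⟨ht0, ht1⟩, htn⟩ := hS.csInf_mem hSne hSb
  set τ := sInf S
  have hτ : 0 < τ := by
    refine lt_of_le_of_ne ht0 fun h0 => htn ?_
    simpa [← h0] using hx
  have hin : ∀ t ∈ Set.Ico 0 τ, x + t • h ∈ interior K := fun t ht => by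
    by_contra hc
    exact absurd (csInf_le hSb (⟨⟨ht.1, ht.2.le.trans ht1⟩, hc⟩ : t ∈ S)) (not_le.2 ht.2)
  set r := localNorm R x h
  have hr0 : 0 ≤ r := localNorm_nonneg x h
  set M := (r / (1 - r)) ^ 2
  have hq : ∀ t ∈ Set.Ico 0 τ, ‖iteratedFDeriv ℝ 2 R (x + t • h) (fun _ => h)‖ ≤ M := by
    intro t ht
    have hrt : r * t ≤ r := mul_le_of_le_one_right hr0 (ht.2.le.trans ht1)
    have h1 := localNorm_line_le hB hH ht.1 (fun s hs => hin s ⟨hs.1, hs.2.trans_lt ht.2⟩)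
      (hrt.trans_lt hr)
    rw [iteratedFDeriv_two_eq_localNorm_sq (hH _ (hin t ht)), Real.norm_eq_abs, abs_sq]
    refine pow_le_pow_left₀ (localNorm_nonneg _ _) (h1.trans ?_) 2
    exact div_le_div_of_nonneg_left hr0 (by linarith) (by linarith)
  have h0mem : (0 : ℝ) ∈ Set.Ico 0 τ := ⟨le_rfl, hτ⟩
  have hd1 : ∀ t ∈ Set.Ico 0 τ, ‖fderiv ℝ R (x + t • h) h‖ ≤ M + ‖fderiv ℝ R x h‖ := by
    intro t ht
    have h1 := Convex.norm_image_sub_le_of_norm_hasDerivWithin_le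
      (fun t ht => (hasDerivAt_line_one hB (hin t ht)).hasDerivWithinAt) hq (convex_Ico 0 τ)
      h0mem ht
    have h2 : M * ‖t - 0‖ ≤ M := by
      refine mul_le_of_le_one_right (sq_nonneg _) ?_
      rw [sub_zero, Real.norm_eq_abs, abs_of_nonneg ht.1]; exact ht.2.le.trans ht1
    simp only [zero_smul, add_zero] at h1
    linarith [norm_sub_norm_le (fderiv ℝ R (x + t • h) h) (fderiv ℝ R x h)]
  have hd0 : ∀ t ∈ Set.Ico 0 τ, R (x + t • h) ≤ R x + (M + ‖fderiv ℝ R x h‖) := by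
    intro t ht
    have h1 := Convex.norm_image_sub_le_of_norm_hasDerivWithin_le
      (fun t ht => (hasDerivAt_line_zero hB (hin t ht)).hasDerivWithinAt) hd1 (convex_Ico 0 τ)
      h0mem ht
    have h2 : (M + ‖fderiv ℝ R x h‖) * ‖t - 0‖ ≤ M + ‖fderiv ℝ R x h‖ := by
      refine mul_le_of_le_one_right (by positivity) ?_
      rw [sub_zero, Real.norm_eq_abs, abs_of_nonneg ht.1]; exact ht.2.le.trans ht1
    simp only [zero_smul, add_zero] at h1
    linarith [le_abs_self (R (x + t • h) - R x), Real.norm_eq_abs (R (x + t • h) - R x)]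
  have hmem : ∀ᶠ t in 𝓝[<] τ, t ∈ Set.Ico 0 τ := by
    filter_upwards [Ico_mem_nhdsLT hτ] with t ht using ht
  have hlim : Tendsto (fun t : ℝ => x + t • h) (𝓝[<] τ) (𝓝[interior K] (x + τ • h)) :=
    tendsto_nhdsWithin_iff.2 ⟨(hcont.tendsto τ).mono_left nhdsWithin_le_nhds,
      hmem.mono fun t ht => hin t ht⟩
  have hfr : x + τ • h ∈ frontier K := by
    refine ⟨closure_mono interior_subset ?_, htn⟩
    exact mem_closure_of_tendsto (hlim.mono_right nhdsWithin_le_nhds) (hmem.mono hin)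
  have hinf := (hB.tendsto_atTop _ hfr).comp hlim
  obtain ⟨t, h1, h2⟩ := ((hinf.eventually_gt_atTop (R x + (M + ‖fderiv ℝ R x h‖))).and hmem).exists
  exact absurd (hd0 t h2) (not_le.2 h1)

theorem add_mem_of_localNorm_le_one (hK : IsClosed K) {x h : EuclideanSpace ℝ (Fin n)}
    (hx : x ∈ interior K) (hr : localNorm R x h ≤ 1) : x + h ∈ K := by
  have hcont : Continuous fun t : ℝ => x + t • h := by fun_prop
  have hlim : Tendsto (fun t : ℝ => x + t • h) (𝓝[<] 1) (𝓝 (x + h)) := by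
    simpa using (hcont.tendsto 1).mono_left (nhdsWithin_le_nhds (s := Set.Iio 1))
  refine hK.mem_of_tendsto hlim ?_
  filter_upwards [Ico_mem_nhdsLT (zero_lt_one (α := ℝ))] with t ht
  refine interior_subset (add_mem_interior_of_localNorm_lt_one hB hH hx ?_)
  rw [localNorm_smul _ _ ht.1]
  nlinarith [ht.1, ht.2, localNorm_nonneg (R := R) x h]

/-- With `h = z - x` and `r` its local norm at `x`, the second derivative along the segment is at
least `(r / (1 + r t))²`, whose integral over `[0, 1]` is `r² / (1 + r)`. -/
theorem localNorm_sq_div_le_fderiv_sub (hKc : Convex ℝ K) {x z : EuclideanSpace ℝ (Fin n)}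
    (hx : x ∈ interior K) (hz : z ∈ interior K) :
    localNorm R x (z - x) ^ 2 / (1 + localNorm R x (z - x)) ≤
      fderiv ℝ R z (z - x) - fderiv ℝ R x (z - x) := by
  set h := z - x with hh
  set r := localNorm R x h
  have hr0 : 0 ≤ r := localNorm_nonneg x h
  have hseg : ∀ t ∈ Set.Icc (0 : ℝ) 1, x + t • h ∈ interior K := fun t ht =>
    hKc.interior.add_smul_sub_mem hx hz ht
  have hden : ∀ t ∈ Set.Icc (0 : ℝ) 1, 0 < 1 + r * t := fun t ht => by
    have := mul_nonneg hr0 ht.1; linarith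
  have hder : ∀ t ∈ Set.Icc (0 : ℝ) 1, HasDerivAt
      (fun t => fderiv ℝ R (x + t • h) h + r * (1 + r * t)⁻¹)
      (iteratedFDeriv ℝ 2 R (x + t • h) (fun _ => h) + r * (-(r * 1) / (1 + r * t) ^ 2)) t :=
    fun t ht => (hasDerivAt_line_one hB (hseg t ht)).add
      (((((hasDerivAt_id t).const_mul r).const_add 1).inv (hden t ht).ne').const_mul r)
  have hmono := monotoneOn_of_hasDerivWithinAt_nonneg (convex_Icc (0 : ℝ) 1)
    (fun t ht => (hder t ht).continuousAt.continuousWithinAt)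
    (fun t ht => (hder t (interior_subset ht)).hasDerivWithinAt) (fun t ht => by
      have ht := interior_subset ht
      have h1 := div_le_localNorm_line hB hH ht.1
        (fun s hs => hseg s ⟨hs.1, hs.2.trans ht.2⟩)
      rw [iteratedFDeriv_two_eq_localNorm_sq (hH _ (hseg t ht))]
      have h2 := pow_le_pow_left₀ (div_nonneg hr0 (hden t ht).le) h1 2
      have h3 : r * (-(r * 1) / (1 + r * t) ^ 2) = -(r / (1 + r * t)) ^ 2 := by
        field_simp
      rw [h3]; linarith)
  have h1 := hmono ⟨le_rfl, zero_le_one⟩ ⟨zero_le_one, le_rfl⟩ zero_le_one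
  simp only [zero_smul, add_zero, mul_zero, inv_one, mul_one, one_smul] at h1
  have hxz : x + h = z := by simp [hh]
  rw [hxz] at h1
  have h2 : r ^ 2 / (1 + r) = r - r * (1 + r)⁻¹ := by
    have : 1 + r ≠ 0 := by positivity
    field_simp; ring
  rw [h2]; linarith

omit hH

theorem fderiv_sq_le (hν : 0 ≤ ν) {x : EuclideanSpace ℝ (Fin n)} (hx : x ∈ interior K)
    (h : EuclideanSpace ℝ (Fin n)) :
    (fderiv ℝ R x h) ^ 2 ≤ ν * iteratedFDeriv ℝ 2 R x (fun _ => h) := by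
  have h0 := iteratedFDeriv_two_nonneg_of_convexOn isOpen_interior hB.convexOn hB.contDiffOn hx h
  have h1 := hB.grad_le x hx h
  rw [← Real.sqrt_eq_rpow, ← Real.sqrt_eq_rpow, ← Real.sqrt_mul hν] at h1
  rw [← sq_abs, ← Real.sq_sqrt (mul_nonneg hν h0)]
  exact pow_le_pow_left₀ (abs_nonneg _) h1 2

/-- Along the segment `exp (-R / (ν + 1))` is concave, because `(R')² ≤ ν R'' ≤ (ν + 1) R''`, and it
is positive at `z`. Hence its value at `1 - δ` is at least `δ` times its value at `0`. Using `ν + 1`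
in place of `ν` keeps the quotient meaningful when `ν = 0`. -/
theorem barrier_sub_le (hν : 0 ≤ ν) (hKc : Convex ℝ K) {x z : EuclideanSpace ℝ (Fin n)}
    (hx : x ∈ interior K) (hz : z ∈ interior K) {δ : ℝ} (hδ : 0 < δ) (hδ1 : δ ≤ 1) :
    R (x + (1 - δ) • (z - x)) - R x ≤ (ν + 1) * Real.log δ⁻¹ := by
  set h := z - x with hh
  have hseg : ∀ t ∈ Set.Icc (0 : ℝ) 1, x + t • h ∈ interior K := fun t ht =>
    hKc.interior.add_smul_sub_mem hx hz ht
  have hμ : 0 < ν + 1 := by linarith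
  set ψ : ℝ → ℝ := fun t => Real.exp (-(R (x + t • h) / (ν + 1)))
  have hd1 : ∀ t ∈ Set.Icc (0 : ℝ) 1, HasDerivAt ψ
      (ψ t * -(fderiv ℝ R (x + t • h) h / (ν + 1))) t := fun t ht =>
    (((hasDerivAt_line_zero hB (hseg t ht)).div_const (ν + 1)).neg).exp
  have hd2 : ∀ t ∈ Set.Icc (0 : ℝ) 1, HasDerivAt
      (fun t => ψ t * -(fderiv ℝ R (x + t • h) h / (ν + 1)))
      ((ψ t * -(fderiv ℝ R (x + t • h) h / (ν + 1))) * -(fderiv ℝ R (x + t • h) h / (ν + 1)) +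
        ψ t * -(iteratedFDeriv ℝ 2 R (x + t • h) (fun _ => h) / (ν + 1))) t := fun t ht =>
    (hd1 t ht).mul (((hasDerivAt_line_one hB (hseg t ht)).div_const (ν + 1)).neg)
  have hconc : ConcaveOn ℝ (Set.Icc 0 1) ψ := by
    refine concaveOn_of_hasDerivWithinAt2_nonpos (convex_Icc 0 1)
      (fun t ht => (hd1 t ht).continuousAt.continuousWithinAt)
      (fun t ht => (hd1 t (interior_subset ht)).hasDerivWithinAt)
      (fun t ht => (hd2 t (interior_subset ht)).hasDerivWithinAt) fun t ht => ?_
    have h1 := fderiv_sq_le hB hν (hseg t (interior_subset ht)) h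
    have h0 := iteratedFDeriv_two_nonneg_of_convexOn isOpen_interior hB.convexOn hB.contDiffOn
      (hseg t (interior_subset ht)) h
    set a := fderiv ℝ R (x + t • h) h
    set b := iteratedFDeriv ℝ 2 R (x + t • h) (fun _ => h)
    have h2 : (ψ t * -(a / (ν + 1))) * -(a / (ν + 1)) + ψ t * -(b / (ν + 1)) =
        ψ t * ((a ^ 2 - (ν + 1) * b) / (ν + 1) ^ 2) := by field_simp; ring
    rw [h2]
    refine mul_nonpos_of_nonneg_of_nonpos (Real.exp_pos _).le
      (div_nonpos_of_nonpos_of_nonneg (by linarith) (sq_nonneg _))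
  have h1 := hconc.2 (⟨le_rfl, zero_le_one⟩ : (0 : ℝ) ∈ Set.Icc (0 : ℝ) 1)
    (⟨zero_le_one, le_rfl⟩ : (1 : ℝ) ∈ Set.Icc (0 : ℝ) 1) hδ.le (by linarith : 0 ≤ 1 - δ)
    (by ring)
  simp only [smul_eq_mul, mul_zero, mul_one, zero_add] at h1
  have h2 : δ * ψ 0 ≤ ψ (1 - δ) :=
    le_trans (le_add_of_nonneg_right (mul_nonneg (by linarith) (Real.exp_pos _).le)) h1
  have h3 := Real.log_le_log (mul_pos hδ (Real.exp_pos _)) h2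
  rw [Real.log_mul hδ.ne' (Real.exp_pos _).ne', Real.log_exp, Real.log_exp] at h3
  simp only [zero_smul, add_zero] at h3
  rw [Real.log_inv]
  have h4 : (R (x + (1 - δ) • h) - R x) / (ν + 1) ≤ -Real.log δ := by rw [sub_div]; linarith
  rw [div_le_iff₀ hμ] at h4
  linarith

end Scrible

/-! ### Regularized leaders: existence, uniqueness, continuous dependence -/

namespace Scrible

variable {n : ℕ} {K : Set (EuclideanSpace ℝ (Fin n))} {ν η : ℝ}
  {R : EuclideanSpace ℝ (Fin n) → ℝ}

/-- Extended by zero outside the interior, `exp (-(g + R))` is continuous on the compact set `K`;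
its maximum is positive, hence attained in the interior. -/
theorem exists_isMinOn_add_barrier (hB : IsSelfConcordantBarrier K ν R) (hK : IsCompact K)
    (hne : (interior K).Nonempty) {g : EuclideanSpace ℝ (Fin n) → ℝ} (hg : Continuous g) :
    ∃ x ∈ interior K, IsMinOn (fun z => g z + R z) (interior K) x := by
  classical
  set Ψ : EuclideanSpace ℝ (Fin n) → ℝ :=
    fun z => if z ∈ interior K then Real.exp (-(g z + R z)) else 0
  have hin : ∀ z ∈ interior K, Ψ z = Real.exp (-(g z + R z)) := fun z hz => if_pos hz
  have hΨ : ContinuousOn Ψ K := by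
    intro z hz
    by_cases hzi : z ∈ interior K
    · have h1 : ContinuousAt (fun z => Real.exp (-(g z + R z))) z :=
        ((hg.continuousAt.add (hB.contDiffOn.contDiffAt
          (isOpen_interior.mem_nhds hzi)).continuousAt).neg).rexp
      exact (h1.congr (eventually_of_mem (isOpen_interior.mem_nhds hzi)
        fun y hy => (hin y hy).symm)).continuousWithinAt
    · have hfr : z ∈ frontier K := ⟨subset_closure hz, hzi⟩
      refine ContinuousAt.continuousWithinAt ?_
      rw [ContinuousAt, show Ψ z = 0 from if_neg hzi, ← nhdsWithin_univ,
        ← Set.union_compl_self (interior K), nhdsWithin_union, tendsto_sup]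
      constructor
      · have h1 : Tendsto (fun y => Real.exp (-(g y + R y))) (𝓝[interior K] z) (𝓝 0) :=
          Real.tendsto_exp_neg_atTop_nhds_zero.comp
            (((hg.tendsto z).mono_left nhdsWithin_le_nhds).add_atTop (hB.tendsto_atTop z hfr))
        exact h1.congr' (eventually_of_mem self_mem_nhdsWithin fun y hy => (hin y hy).symm)
      · exact tendsto_const_nhds.congr'
          (eventually_of_mem self_mem_nhdsWithin fun y hy => (if_neg hy).symm)
  obtain ⟨x₀, hx₀⟩ := hne
  obtain ⟨x, hxK, hmax⟩ := hK.exists_isMaxOn ⟨x₀, interior_subset hx₀⟩ hΨ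
  have hxi : x ∈ interior K := by
    by_contra hc
    have h1 : Ψ x₀ ≤ Ψ x := hmax (interior_subset hx₀)
    rw [hin x₀ hx₀, show Ψ x = 0 from if_neg hc] at h1
    exact absurd h1 (not_le.2 (Real.exp_pos _))
  refine ⟨x, hxi, fun z hz => ?_⟩
  have h1 : Ψ z ≤ Ψ x := hmax (interior_subset hz)
  rw [hin z hz, hin x hxi, Real.exp_le_exp] at h1
  exact neg_le_neg_iff.1 h1

/-- `x` is a stationary point of `η ⟪G, ·⟫ + R` in `int K`. -/
def IsIterate (K : Set (EuclideanSpace ℝ (Fin n))) (R : EuclideanSpace ℝ (Fin n) → ℝ) (η : ℝ)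
    (G x : EuclideanSpace ℝ (Fin n)) : Prop :=
  x ∈ interior K ∧ ∀ h, fderiv ℝ R x h = -(η * inner ℝ G h)

theorem isIterate_of_isMinOn (hB : IsSelfConcordantBarrier K ν R)
    {G x : EuclideanSpace ℝ (Fin n)} (hx : x ∈ interior K)
    (hmin : IsMinOn (fun z => η * inner ℝ G z + R z) (interior K) x) : IsIterate K R η G x := by
  refine ⟨hx, fun h => ?_⟩
  have hd : DifferentiableAt ℝ R x :=
    (hB.contDiffOn.contDiffAt (isOpen_interior.mem_nhds hx)).differentiableAt (by norm_num)
  have h1 : HasFDerivAt (fun z => η * inner ℝ G z + R z) (η • innerSL ℝ G + fderiv ℝ R x) x :=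
    ((innerSL ℝ G).hasFDerivAt.const_mul η).add hd.hasFDerivAt
  have h2 := (hmin.isLocalMin (isOpen_interior.mem_nhds hx)).hasFDerivAt_eq_zero h1
  have h3 := DFunLike.congr_fun h2 h
  simp at h3
  linarith

theorem rftl_spec (hB : IsSelfConcordantBarrier K ν R) (hK : IsCompact K)
    (hne : (interior K).Nonempty) (η : ℝ) (G : EuclideanSpace ℝ (Fin n)) :
    rftl K R η G ∈ interior K ∧
      IsMinOn (fun z => η * inner ℝ G z + R z) (interior K) (rftl K R η G) := by
  obtain ⟨x, hx⟩ := exists_isMinOn_add_barrier hB hK hne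
    (g := fun z => η * inner ℝ G z) (by fun_prop)
  exact Classical.epsilon_spec (p := fun x => x ∈ interior K ∧
    IsMinOn (fun z => η * inner ℝ G z + R z) (interior K) x) ⟨x, hx⟩

theorem isIterate_rftl (hB : IsSelfConcordantBarrier K ν R) (hK : IsCompact K)
    (hne : (interior K).Nonempty) (η : ℝ) (G : EuclideanSpace ℝ (Fin n)) :
    IsIterate K R η G (rftl K R η G) :=
  isIterate_of_isMinOn hB (rftl_spec hB hK hne η G).1 (rftl_spec hB hK hne η G).2

theorem isIterate_start (hB : IsSelfConcordantBarrier K ν R) (hK : IsCompact K)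
    (hne : (interior K).Nonempty) (η : ℝ) : IsIterate K R η 0 (start K R) := by
  have h1 := isIterate_rftl hB hK hne η 0
  have h2 : start K R ∈ interior K ∧ fderiv ℝ R (start K R) = 0 :=
    Classical.epsilon_spec (p := fun x => x ∈ interior K ∧ fderiv ℝ R x = 0)
      ⟨_, h1.1, by ext h; simpa using h1.2 h⟩
  exact ⟨h2.1, fun h => by simp [h2.2]⟩

variable (hB : IsSelfConcordantBarrier K ν R) (hH : ∀ x ∈ interior K, (hessian R x).PosDef)
  (hKc : Convex ℝ K)

include hB hH hKc

/-- Stationarity turns the gradient difference of `R` into a difference of linear terms. Uniqueness,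
continuity in `G` and the stability of one round all follow from this inequality. -/
theorem IsIterate.localNorm_sq_div_le {G G' x z : EuclideanSpace ℝ (Fin n)}
    (hx : IsIterate K R η G x) (hz : IsIterate K R η G' z) :
    localNorm R x (z - x) ^ 2 / (1 + localNorm R x (z - x)) ≤
      η * inner ℝ (G' - G) (x - z) := by
  have h1 := localNorm_sq_div_le_fderiv_sub hB hH hKc hx.1 hz.1
  rw [hx.2, hz.2] at h1
  refine h1.trans_eq ?_
  rw [← neg_sub z x, inner_neg_right, inner_sub_left]; ring

theorem IsIterate.unique {G x z : EuclideanSpace ℝ (Fin n)}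
    (hx : IsIterate K R η G x) (hz : IsIterate K R η G z) : z = x := by
  by_contra hne
  have h1 := hx.localNorm_sq_div_le hB hH hKc hz
  have h2 := localNorm_pos (hH x hx.1) (sub_ne_zero.2 hne)
  have h3 : 0 < localNorm R x (z - x) ^ 2 / (1 + localNorm R x (z - x)) := by positivity
  simp at h1
  linarith

/-- Boundedness of `K` bounds the factor `1 + r` in the preceding estimate, leaving `r²` at most a
constant times `‖G - G₀‖`. The local norm at the fixed point `X G₀` then controls the Euclidean one.
-/
theorem continuous_of_isIterate (hK : IsCompact K)
    {X : EuclideanSpace ℝ (Fin n) → EuclideanSpace ℝ (Fin n)}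
    (hX : ∀ G, IsIterate K R η G (X G)) : Continuous X := by
  refine continuous_iff_continuousAt.2 fun G₀ => ?_
  obtain ⟨D, hD⟩ := Metric.isBounded_iff.1 hK.isBounded
  set L := (Matrix.toEuclideanLin (dikinMatrix R (X G₀))).toContinuousLinearMap
  set L' := (Matrix.toEuclideanLin (dikinMatrix R (X G₀))⁻¹).toContinuousLinearMap
  have hle : ∀ G, ‖X G - X G₀‖ ≤ ‖L‖ * √((1 + ‖L'‖ * D) * (|η| * D * ‖G - G₀‖)) := by
    intro G
    set r := localNorm R (X G₀) (X G - X G₀)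
    have hr0 : 0 ≤ r := localNorm_nonneg _ _
    have hdist : ‖X G - X G₀‖ ≤ D := by
      rw [← dist_eq_norm]
      exact hD (interior_subset (hX G).1) (interior_subset (hX G₀).1)
    have hrD : r ≤ ‖L'‖ * D := (L'.le_opNorm (X G - X G₀)).trans (by gcongr)
    have h1 := (hX G₀).localNorm_sq_div_le hB hH hKc (hX G)
    have h2 : η * inner ℝ (G - G₀) (X G₀ - X G) ≤ |η| * D * ‖G - G₀‖ := by
      refine (le_abs_self _).trans ?_
      rw [abs_mul, mul_assoc]
      refine mul_le_mul_of_nonneg_left ?_ (abs_nonneg _)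
      refine (abs_real_inner_le_norm _ _).trans ?_
      rw [norm_sub_rev (X G₀), mul_comm]
      gcongr
    have h3 : r ^ 2 ≤ (1 + ‖L'‖ * D) * (|η| * D * ‖G - G₀‖) := by
      have h4 := h1.trans h2
      rw [div_le_iff₀ (by positivity)] at h4
      have h5 : 0 ≤ |η| * D * ‖G - G₀‖ := by
        have := (norm_nonneg _).trans hdist; positivity
      nlinarith
    have h6 : r ≤ √((1 + ‖L'‖ * D) * (|η| * D * ‖G - G₀‖)) := Real.le_sqrt_of_sq_le h3
    calc ‖X G - X G₀‖ = ‖L (L' (X G - X G₀))‖ := by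
          congr 1
          exact (dikinMatrix_apply_inv_apply (hH _ (hX G₀).1) _).symm
      _ ≤ ‖L‖ * r := L.le_opNorm _
      _ ≤ _ := by gcongr
  rw [ContinuousAt, tendsto_iff_norm_sub_tendsto_zero]
  refine squeeze_zero (fun _ => norm_nonneg _) hle ?_
  have hc : Continuous fun G => ‖L‖ * √((1 + ‖L'‖ * D) * (|η| * D * ‖G - G₀‖)) := by fun_prop
  simpa using hc.tendsto G₀

end Scrible

/-- The Euclidean unit sphere of `ℝⁿ`. -/
abbrev UnitSphere (n : ℕ) : Set (EuclideanSpace ℝ (Fin n)) := Metric.sphere 0 1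

/-! ### First and second moments of the uniform law on the sphere -/

section Sphere

open scoped Pointwise

variable {n : ℕ}

/-- The action of a linear isometry on the unit sphere. -/
noncomputable def sphereMap (e : EuclideanSpace ℝ (Fin n) ≃ₗᵢ[ℝ] EuclideanSpace ℝ (Fin n))
    (u : UnitSphere n) : UnitSphere n :=
  ⟨e u, by simp⟩

theorem continuous_sphereMap (e : EuclideanSpace ℝ (Fin n) ≃ₗᵢ[ℝ] EuclideanSpace ℝ (Fin n)) :
    Continuous (sphereMap e) :=
  (e.continuous.comp continuous_subtype_val).subtype_mk _

/-- Surface measure is, up to a constant, the volume of the cone over a set, and isometries preserve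
both cones and volume. -/
theorem map_sphereMap_toSphere
    (e : EuclideanSpace ℝ (Fin n) ≃ₗᵢ[ℝ] EuclideanSpace ℝ (Fin n)) :
    (volume : Measure (EuclideanSpace ℝ (Fin n))).toSphere.map (sphereMap e) =
      (volume : Measure (EuclideanSpace ℝ (Fin n))).toSphere := by
  ext s hs
  have hm := (continuous_sphereMap e).measurable
  rw [Measure.map_apply hm hs, Measure.toSphere_apply' _ (hm hs), Measure.toSphere_apply' _ hs]
  congr 1
  have hset : Set.Ioo (0 : ℝ) 1 • (Subtype.val '' (sphereMap e ⁻¹' s)) =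
      e.toMeasurableEquiv ⁻¹' (Set.Ioo (0 : ℝ) 1 • (Subtype.val '' s)) := by
    ext v
    simp only [Set.mem_smul, Set.mem_preimage, Set.mem_image]
    constructor
    · rintro ⟨t, ht, _, ⟨w, hw, rfl⟩, rfl⟩
      exact ⟨t, ht, _, ⟨sphereMap e w, hw, rfl⟩, by simp [sphereMap]⟩
    · rintro ⟨t, ht, _, ⟨w, hw, rfl⟩, hv⟩
      have hew : sphereMap e (sphereMap e.symm w) = w := by ext1; simp [sphereMap]
      refine ⟨t, ht, _, ⟨sphereMap e.symm w, by rwa [hew], rfl⟩, ?_⟩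
      apply e.injective
      have hv' : t • (w : EuclideanSpace ℝ (Fin n)) = e v := hv
      simp [sphereMap, hv']
  rw [hset]
  exact e.measurePreserving.measure_preimage_equiv (f := e.toMeasurableEquiv) _

theorem map_sphereMap_sphereUniform
    (e : EuclideanSpace ℝ (Fin n) ≃ₗᵢ[ℝ] EuclideanSpace ℝ (Fin n)) :
    (sphereUniform n).map (sphereMap e) = sphereUniform n := by
  rw [sphereUniform, Measure.map_smul, map_sphereMap_toSphere]

theorem isProbabilityMeasure_sphereUniform (hn : 1 ≤ n) :
    IsProbabilityMeasure (sphereUniform n) := by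
  have : NeZero n := ⟨by omega⟩
  constructor
  rw [sphereUniform, Measure.smul_apply, smul_eq_mul]
  exact ENNReal.inv_mul_cancel (by
    rw [Ne, Measure.measure_univ_eq_zero]
    exact Measure.toSphere_ne_zero (E := EuclideanSpace ℝ (Fin n)) _) (measure_ne_top _ _)

theorem integral_comp_sphereMap
    (e : EuclideanSpace ℝ (Fin n) ≃ₗᵢ[ℝ] EuclideanSpace ℝ (Fin n)) {φ : UnitSphere n → ℝ}
    (hφ : Continuous φ) :
    ∫ u, φ (sphereMap e u) ∂(sphereUniform n) = ∫ u, φ u ∂(sphereUniform n) := by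
  conv_rhs => rw [← map_sphereMap_sphereUniform e]
  exact (integral_map (continuous_sphereMap e).aemeasurable hφ.aestronglyMeasurable).symm

theorem integral_inner_sphereUniform (a : EuclideanSpace ℝ (Fin n)) :
    ∫ u : UnitSphere n, inner ℝ a (u : EuclideanSpace ℝ (Fin n)) ∂(sphereUniform n) = 0 := by
  have h := integral_comp_sphereMap (LinearIsometryEquiv.neg ℝ)
    (φ := fun u : UnitSphere n => inner ℝ a (u : EuclideanSpace ℝ (Fin n))) (by fun_prop)
  simp only [sphereMap, LinearIsometryEquiv.coe_neg, inner_neg_right, integral_neg] at h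
  linarith

theorem integral_inner_mul_inner_isometry
    (e : EuclideanSpace ℝ (Fin n) ≃ₗᵢ[ℝ] EuclideanSpace ℝ (Fin n))
    (a b : EuclideanSpace ℝ (Fin n)) :
    ∫ u : UnitSphere n, inner ℝ (e a) u.1 * inner ℝ (e b) u.1
      ∂(sphereUniform n) =
    ∫ u : UnitSphere n, inner ℝ a u.1 * inner ℝ b u.1 ∂(sphereUniform n) := by
  have h := integral_comp_sphereMap e (φ := fun u : UnitSphere n =>
    inner ℝ (e a) u.1 * inner ℝ (e b) u.1) (by fun_prop)
  simpa only [sphereMap, LinearIsometryEquiv.inner_map_map] using h.symm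

/-- The reflection in the hyperplane orthogonal to `a` negates `a` and fixes `b`, so the integral
equals its negative. -/
theorem integral_inner_mul_inner_of_orthogonal {a b : EuclideanSpace ℝ (Fin n)}
    (hab : inner ℝ a b = 0) :
    ∫ u : UnitSphere n, inner ℝ a u.1 * inner ℝ b u.1 ∂(sphereUniform n) = 0 := by
  have h := integral_inner_mul_inner_isometry (Submodule.reflection (ℝ ∙ a)ᗮ) a b
  rw [Submodule.reflection_orthogonalComplement_singleton_eq_neg,
    Submodule.reflection_mem_subspace_eq_self
      (Submodule.mem_orthogonal_singleton_iff_inner_right.2 hab)] at h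
  simp only [inner_neg_left, neg_mul, integral_neg] at h
  linarith

theorem integral_inner_sq_eq_of_norm_eq {a b : EuclideanSpace ℝ (Fin n)} (hab : ‖a‖ = ‖b‖) :
    ∫ u : UnitSphere n, inner ℝ b u.1 * inner ℝ b u.1 ∂(sphereUniform n) =
    ∫ u : UnitSphere n, inner ℝ a u.1 * inner ℝ a u.1 ∂(sphereUniform n) := by
  rw [← integral_inner_mul_inner_isometry (Submodule.reflection (ℝ ∙ (a - b))ᗮ) a a,
    Submodule.reflection_sub hab]

theorem integrable_sphereUniform (hn : 1 ≤ n) {φ : UnitSphere n → ℝ} (hφ : Continuous φ) :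
    Integrable φ (sphereUniform n) := by
  have := isProbabilityMeasure_sphereUniform hn
  exact hφ.integrable_of_hasCompactSupport (HasCompactSupport.of_compactSpace _)

/-- In an orthonormal basis the off-diagonal moments vanish, and the `n` diagonal ones are equal
with sum 1 since `‖u‖ = 1`. -/
theorem integral_inner_mul_inner_sphereUniform (hn : 1 ≤ n) (a b : EuclideanSpace ℝ (Fin n)) :
    ∫ u : UnitSphere n, inner ℝ a u.1 * inner ℝ b u.1 ∂(sphereUniform n) =
      inner ℝ a b / n := by
  have := isProbabilityMeasure_sphereUniform hn
  set B := fun a b : EuclideanSpace ℝ (Fin n) =>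
    ∫ u : UnitSphere n, inner ℝ a u.1 * inner ℝ b u.1 ∂(sphereUniform n)
  set s := EuclideanSpace.basisFun (Fin n) ℝ
  have hcoord : ∀ (i j : Fin n), B (s i) (s j) = if i = j then (n : ℝ)⁻¹ else 0 := by
    intro i j
    split_ifs with hij
    · subst hij
      have h1 : ∀ j, B (s j) (s j) = B (s i) (s i) := fun j =>
        integral_inner_sq_eq_of_norm_eq (by simp)
      have h2 : ∑ j, B (s j) (s j) = 1 := by
        rw [← integral_finsetSum _ fun j _ => integrable_sphereUniform hn (by fun_prop)]
        have h3 : ∀ u : UnitSphere n, ∑ j, inner ℝ (s j) u.1 * inner ℝ (s j) u.1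
            = 1 := fun u => by
          have h4 := s.sum_sq_norm_inner_right u.1
          simpa [sq] using h4
        simp [h3]
      simp only [h1, Finset.sum_const, Finset.card_univ, Fintype.card_fin, nsmul_eq_mul] at h2
      exact eq_inv_of_mul_eq_one_right h2
    · exact integral_inner_mul_inner_of_orthogonal (s.inner_eq_zero hij)
  have hexp : B a b = ∑ i, ∑ j, (inner ℝ (s i) a * inner ℝ (s j) b) * B (s i) (s j) := by
    have h1 : ∀ u : UnitSphere n, inner ℝ a u.1 * inner ℝ b u.1 =
        ∑ i, ∑ j, (inner ℝ (s i) a * inner ℝ (s j) b) *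
          (inner ℝ (s i) u.1 * inner ℝ (s j) u.1) := fun u => by
      rw [← s.sum_inner_mul_inner a u.1, ← s.sum_inner_mul_inner b u.1, Finset.sum_mul_sum]
      refine Finset.sum_congr rfl fun i _ => Finset.sum_congr rfl fun j _ => ?_
      rw [real_inner_comm a, real_inner_comm b]; ring
    simp only [B, h1]
    rw [integral_finsetSum _ fun i _ => integrable_sphereUniform hn (by fun_prop)]
    refine Finset.sum_congr rfl fun i _ => ?_
    rw [integral_finsetSum _ fun j _ => integrable_sphereUniform hn (by fun_prop)]
    exact Finset.sum_congr rfl fun j _ => integral_const_mul _ _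
  change B a b = _
  rw [hexp, ← s.sum_inner_mul_inner a b, Finset.sum_div]
  refine Finset.sum_congr rfl fun i _ => ?_
  simp [hcoord, real_inner_comm, div_eq_mul_inv]

end Sphere

/-! ### The gradient estimator and the pathwise regret bound -/

namespace Scrible

variable {n : ℕ} {K : Set (EuclideanSpace ℝ (Fin n))} {ν η : ℝ}
  {R : EuclideanSpace ℝ (Fin n) → ℝ}

theorem exists_inner_eq (f : EuclideanSpace ℝ (Fin n) →ₗ[ℝ] ℝ) :
    ∃ a : EuclideanSpace ℝ (Fin n), ∀ z, f z = inner ℝ a z :=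
  ⟨(InnerProductSpace.toDual ℝ _).symm f.toContinuousLinearMap, fun z => by simp⟩

theorem inner_estimate (R : EuclideanSpace ℝ (Fin n) → ℝ) (x u z : EuclideanSpace ℝ (Fin n))
    (v : ℝ) : inner ℝ (estimate R x u v) z =
      n * v * inner ℝ (Matrix.toEuclideanLin (dikinMatrix R x)⁻¹ z) u := by
  rw [estimate, inner_smul_left, inner_toEuclideanLin_comm (dikinMatrix_isHermitian R x).inv,
    real_inner_comm]
  simp

/-- The estimator is unbiased, and so is the loss of the perturbed point. -/
theorem integral_loss_sub_inner_estimate (hn : 1 ≤ n) {x : EuclideanSpace ℝ (Fin n)}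
    (hH : (hessian R x).PosDef) (f : EuclideanSpace ℝ (Fin n) →ₗ[ℝ] ℝ)
    (w : EuclideanSpace ℝ (Fin n)) :
    ∫ u : UnitSphere n, (f (play R x u) - f w -
      inner ℝ (estimate R x u (f (play R x u))) (x - w)) ∂(sphereUniform n) = 0 := by
  have := isProbabilityMeasure_sphereUniform hn
  obtain ⟨a, ha⟩ := exists_inner_eq f
  set a' := Matrix.toEuclideanLin (dikinMatrix R x) a
  set b := Matrix.toEuclideanLin (dikinMatrix R x)⁻¹ (x - w)
  -- Terms linear in `u` have mean zero. The quadratic term has mean `⟪A a, A⁻¹ (x - w)⟫ = ⟪a, x -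
  -- w⟫`, which cancels the constant.
  have h1 : ∀ u : UnitSphere n, f (play R x u) - f w -
      inner ℝ (estimate R x u (f (play R x u))) (x - w) = inner ℝ a (x - w) + inner ℝ a' u.1 -
      (n * inner ℝ a x * inner ℝ b u.1 + n * (inner ℝ a' u.1 * inner ℝ b u.1)) := fun u => by
    rw [inner_estimate, play, map_add, ha, ha, ha, ← inner_toEuclideanLin_comm
      (dikinMatrix_isHermitian R x), inner_sub_right]
    ring
  have hi := fun {φ : UnitSphere n → ℝ} =>
    integrable_sphereUniform hn (φ := φ)
  simp only [h1]
  rw [integral_sub (hi (by fun_prop)) (hi (by fun_prop)),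
    integral_add (hi (by fun_prop)) (hi (by fun_prop)),
    integral_add (hi (by fun_prop)) (hi (by fun_prop)), integral_const_mul, integral_const_mul,
    integral_inner_sphereUniform, integral_inner_sphereUniform,
    integral_inner_mul_inner_sphereUniform hn,
    inner_toEuclideanLin_comm (dikinMatrix_isHermitian R x), dikinMatrix_apply_inv_apply hH]
  have hn0 : (n : ℝ) ≠ 0 := by positivity
  simp
  field_simp
  ring

section Rounds

variable {f : ℕ → EuclideanSpace ℝ (Fin n) → ℝ} {u : ℕ → EuclideanSpace ℝ (Fin n)}

/-- The state before round `t` is a function of the earlier draws alone, hence independent of `u t`.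
-/
theorem state_congr {u' : ℕ → EuclideanSpace ℝ (Fin n)} {t : ℕ} (h : ∀ s < t, u s = u' s) :
    state K R η f u t = state K R η f u' t := by
  induction t with
  | zero => rfl
  | succ t ih =>
    have ih := ih fun s hs => h s (hs.trans t.lt_succ_self)
    simp only [state, ih, h t t.lt_succ_self]

/-- The gradient estimate of round `t`. -/
noncomputable def grad (K : Set (EuclideanSpace ℝ (Fin n))) (R : EuclideanSpace ℝ (Fin n) → ℝ)
    (η : ℝ) (f : ℕ → EuclideanSpace ℝ (Fin n) → ℝ) (u : ℕ → EuclideanSpace ℝ (Fin n)) (t : ℕ) :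
    EuclideanSpace ℝ (Fin n) :=
  estimate R (state K R η f u t).1 (u t) (f t (action K R η f u t))

theorem state_succ_snd (t : ℕ) :
    (state K R η f u (t + 1)).2 = (state K R η f u t).2 + grad K R η f u t := rfl

variable (hB : IsSelfConcordantBarrier K ν R) (hH : ∀ x ∈ interior K, (hessian R x).PosDef)
  (hKc : Convex ℝ K) (hK : IsCompact K) (hne : (interior K).Nonempty)

include hB hK hne in
theorem isIterate_state (t : ℕ) :
    IsIterate K R η (state K R η f u t).2 (state K R η f u t).1 := by
  cases t with
  | zero => exact isIterate_start hB hK hne η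
  | succ t => exact isIterate_rftl hB hK hne η _

include hB hH hK hne in
-- The displacement `A u` has local norm `‖u‖ = 1`.
theorem action_mem (hu : ∀ t, ‖u t‖ = 1) (t : ℕ) : action K R η f u t ∈ K := by
  have hx := (isIterate_state (η := η) (f := f) (u := u) hB hK hne t).1
  refine add_mem_of_localNorm_le_one hB hH hK.isClosed hx ?_
  rw [localNorm, Matrix.toLpLin_apply, Matrix.toLpLin_apply]
  simp [Matrix.nonsing_inv_mul _ (isUnit_det_dikinMatrix (hH _ hx)), hu]

include hB hH hKc hK hne

/-- In round 0 the point is only known to be stationary; uniqueness identifies it with the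
minimizer. -/
theorem isMinOn_state (t : ℕ) :
    IsMinOn (fun z => η * inner ℝ (state K R η f u t).2 z + R z) (interior K)
      (state K R η f u t).1 := by
  rw [(isIterate_rftl hB hK hne η (state K R η f u t).2).unique hB hH hKc
    (isIterate_state hB hK hne t)]
  exact (rftl_spec hB hK hne η _).2

/-- Be-the-leader: the induction hypothesis is used at the new iterate, and optimality of that
iterate then brings in `w`. -/
theorem sum_inner_grad_next_le {w : EuclideanSpace ℝ (Fin n)} (hw : w ∈ interior K) (t : ℕ) :
    η * ∑ s ∈ Finset.range t, inner ℝ (grad K R η f u s) (state K R η f u (s + 1)).1 +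
      R (start K R) ≤ η * inner ℝ (state K R η f u t).2 w + R w := by
  induction t generalizing w with
  | zero => simpa [state] using isMinOn_state (η := η) (f := f) (u := u) hB hH hKc hK hne 0 hw
  | succ t ih =>
    have h1 := isMinOn_state (η := η) (f := f) (u := u) hB hH hKc hK hne (t + 1) hw
    have h2 := ih (isIterate_state (η := η) (f := f) (u := u) hB hK hne (t + 1)).1
    simp only [Set.mem_ofPred_eq] at h1
    rw [Finset.sum_range_succ, mul_add]
    refine le_trans ?_ h1
    rw [state_succ_snd, inner_add_left]
    linarith

/-- With `r` the local length of the step, `⟪g, x - z⟫ ≤ n r` by Cauchy–Schwarz in the local norm.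
Then `r² / (1 + r) ≤ η n r`, and `η n ≤ 1 / 2` yields `r ≤ 2 η n`. -/
theorem inner_grad_sub_next_le (hu : ∀ t, ‖u t‖ = 1) (hη : 0 < η) (hηn : η * n ≤ 1 / 2) {t : ℕ}
    (hf : ∀ x ∈ K, |f t x| ≤ 1) :
    inner ℝ (grad K R η f u t) ((state K R η f u t).1 - (state K R η f u (t + 1)).1) ≤
      2 * η * n ^ 2 := by
  have hx := isIterate_state (η := η) (f := f) (u := u) hB hK hne t
  have h1 := hx.localNorm_sq_div_le hB hH hKc
    (isIterate_state (f := f) (u := u) hB hK hne (t + 1))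
  rw [state_succ_snd, add_sub_cancel_left] at h1
  set x := (state K R η f u t).1
  set z := (state K R η f u (t + 1)).1
  set r := localNorm R x (z - x)
  have hr0 : 0 ≤ r := localNorm_nonneg _ _
  have hv : |f t (action K R η f u t)| ≤ 1 := hf _ (action_mem hB hH hK hne hu t)
  have h2 : inner ℝ (grad K R η f u t) (x - z) ≤ n * r := by
    rw [grad, inner_estimate]
    refine (le_abs_self _).trans ?_
    rw [abs_mul, abs_mul, abs_of_nonneg (Nat.cast_nonneg n : (0 : ℝ) ≤ n), mul_assoc]
    refine mul_le_mul_of_nonneg_left ?_ (Nat.cast_nonneg n)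
    refine (mul_le_of_le_one_left (abs_nonneg _) hv).trans ((abs_real_inner_le_norm _ _).trans ?_)
    rw [hu, mul_one, ← neg_sub z x, map_neg, norm_neg]
    rfl
  have h3 : r ^ 2 ≤ η * (n * r) * (1 + r) := by
    have h4 := h1.trans (mul_le_mul_of_nonneg_left h2 hη.le)
    rwa [div_le_iff₀ (by positivity)] at h4
  have h5 : r ≤ 2 * η * n := by
    rcases hr0.eq_or_lt with h0 | h0
    · rw [← h0]; positivity
    · have h6 : r ≤ η * n * (1 + r) := le_of_mul_le_mul_right (by linarith) h0
      nlinarith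
  calc _ ≤ n * r := h2
    _ ≤ n * (2 * η * n) := by gcongr
    _ = _ := by ring

theorem sum_inner_grad_sub_le (hu : ∀ t, ‖u t‖ = 1) (hη : 0 < η) (hηn : η * n ≤ 1 / 2) {T : ℕ}
    (hf : ∀ t < T, ∀ x ∈ K, |f t x| ≤ 1) {w : EuclideanSpace ℝ (Fin n)} (hw : w ∈ interior K) :
    ∑ t ∈ Finset.range T, inner ℝ (grad K R η f u t) ((state K R η f u t).1 - w) ≤
      T * (2 * η * n ^ 2) + (R w - R (start K R)) / η := by
  have h1 := sum_inner_grad_next_le (η := η) (f := f) (u := u) hB hH hKc hK hne hw T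
  have hG : ∀ t, inner ℝ (state K R η f u t).2 w =
      ∑ s ∈ Finset.range t, inner ℝ (grad K R η f u s) w := by
    intro t
    induction t with
    | zero => simp [state]
    | succ t ih => rw [state_succ_snd, inner_add_left, ih, Finset.sum_range_succ]
  rw [hG] at h1
  have h2 : ∑ t ∈ Finset.range T, inner ℝ (grad K R η f u t)
      ((state K R η f u t).1 - (state K R η f u (t + 1)).1) ≤ T * (2 * η * n ^ 2) := by
    refine (Finset.sum_le_sum fun t ht => inner_grad_sub_next_le hB hH hKc hK hne hu hη hηn
      (hf t (Finset.mem_range.1 ht))).trans_eq ?_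
    simp
  have h3 : ∑ s ∈ Finset.range T, inner ℝ (grad K R η f u s) (state K R η f u (s + 1)).1 -
      ∑ s ∈ Finset.range T, inner ℝ (grad K R η f u s) w ≤ (R w - R (start K R)) / η := by
    rw [le_div_iff₀ hη]; linarith
  simp only [inner_sub_right, Finset.sum_sub_distrib] at h2 ⊢
  linarith

end Rounds

/-! ### Continuity of the state in the draws -/

section Continuity

variable {X : Type*} [TopologicalSpace X]

theorem continuous_toEuclideanLin {M : X → Matrix (Fin n) (Fin n) ℝ}
    {v : X → EuclideanSpace ℝ (Fin n)} (hM : Continuous M) (hv : Continuous v) :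
    Continuous fun a => Matrix.toEuclideanLin (M a) (v a) := by
  simp only [Matrix.toLpLin_apply]
  exact (PiLp.continuous_toLp 2 _).comp (hM.matrix_mulVec ((PiLp.continuous_ofLp 2 _).comp hv))

variable (hB : IsSelfConcordantBarrier K ν R) (hH : ∀ x ∈ interior K, (hessian R x).PosDef)

include hB hH

theorem continuous_play {x v : X → EuclideanSpace ℝ (Fin n)} (hx : Continuous x)
    (hxK : ∀ a, x a ∈ interior K) (hv : Continuous v) : Continuous fun a => play R (x a) (v a) :=
  hx.add (continuous_toEuclideanLin
    ((continuousOn_dikinMatrix isOpen_interior hB.contDiffOn hH).comp_continuous hx hxK) hv)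

theorem continuous_estimate {x v : X → EuclideanSpace ℝ (Fin n)} {l : X → ℝ} (hx : Continuous x)
    (hxK : ∀ a, x a ∈ interior K) (hv : Continuous v) (hl : Continuous l) :
    Continuous fun a => estimate R (x a) (v a) (l a) :=
  (continuous_const.mul hl).smul (continuous_toEuclideanLin
    ((continuousOn_inv_dikinMatrix isOpen_interior hB.contDiffOn hH).comp_continuous hx hxK) hv)

theorem continuous_state (hKc : Convex ℝ K) (hK : IsCompact K) (hne : (interior K).Nonempty)
    {f : ℕ → EuclideanSpace ℝ (Fin n) → ℝ} (hf : ∀ t, Continuous (f t))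
    {v : ℕ → X → EuclideanSpace ℝ (Fin n)} (hv : ∀ t, Continuous (v t)) (t : ℕ) :
    Continuous fun a => state K R η f (fun s => v s a) t := by
  induction t with
  | zero => exact continuous_const
  | succ t ih =>
    have hxK := fun a => (isIterate_state (η := η) (f := f) (u := fun s => v s a) hB hK hne t).1
    have hG : Continuous fun a => (state K R η f (fun s => v s a) (t + 1)).2 :=
      ih.snd.add (continuous_estimate hB hH ih.fst hxK (hv t)
        ((hf t).comp (continuous_play hB hH ih.fst hxK (hv t))))
    exact ((continuous_of_isIterate hB hH hKc hK fun G =>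
      isIterate_rftl hB hK hne η G).comp hG).prodMk hG

end Continuity

end Scrible

/-! ### Taking expectations -/

/-- Stands in for conditioning on the past: by independence the joint law of the earlier draws and
`u t` is a product, and Fubini integrates over the current draw first. A continuous `Φ` is
integrable because the product of spheres is compact. -/
theorem integrable_and_integral_comp_prefix {n : ℕ} (hn : 1 ≤ n) {Ω : Type*} [MeasurableSpace Ω]
    {P : Measure Ω} [IsProbabilityMeasure P]
    {u : ℕ → Ω → UnitSphere n}
    (hu : ∀ t, HasLaw (u t) (sphereUniform n) P) (hind : iIndepFun u P) (t : ℕ)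
    {Φ : (Finset.range t → UnitSphere n) ×
      UnitSphere n → ℝ} (hΦ : Continuous Φ) :
    Integrable (fun ω => Φ (fun i => u i ω, u t ω)) P ∧
      ((∀ b, ∫ s, Φ (b, s) ∂(sphereUniform n) = 0) →
        ∫ ω, Φ (fun i => u i ω, u t ω) ∂P = 0) := by
  have := isProbabilityMeasure_sphereUniform hn
  set Y : Ω → (Finset.range t → UnitSphere n) :=
    fun ω i => u i ω
  have hum : ∀ s, AEMeasurable (u s) P := fun s => (hu s).aemeasurable
  have hYm : AEMeasurable Y P := aemeasurable_pi_lambda _ fun i => hum i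
  have hI : IndepFun Y (u t) P :=
    (hind.indepFun_finset₀ (Finset.range t) {t} (by simp) hum).comp measurable_id
      (measurable_pi_apply (⟨t, Finset.mem_singleton_self t⟩ : ({t} : Finset ℕ)))
  have hmap := (indepFun_iff_map_prod_eq_prod_map_map hYm (hum t)).1 hI
  rw [(hu t).map_eq] at hmap
  have hpm := hYm.prodMk (hum t)
  have : IsProbabilityMeasure (P.map Y) := Measure.isProbabilityMeasure_map hYm
  have hint : Integrable Φ ((P.map Y).prod (sphereUniform n)) :=
    hΦ.integrable_of_hasCompactSupport (HasCompactSupport.of_compactSpace _)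
  constructor
  · have h1 := hint
    rw [← hmap] at h1
    exact h1.comp_aemeasurable hpm
  · intro h0
    have h1 : ∫ ω, Φ (Y ω, u t ω) ∂P = ∫ p, Φ p ∂((P.map Y).prod (sphereUniform n)) := by
      rw [← hmap]
      exact (integral_map hpm hΦ.aestronglyMeasurable).symm
    rw [h1, integral_prod _ hint]
    simp [h0]

namespace Scrible

variable {n : ℕ} {K : Set (EuclideanSpace ℝ (Fin n))} {ν η : ℝ}
  {R : EuclideanSpace ℝ (Fin n) → ℝ}
  (hB : IsSelfConcordantBarrier K ν R) (hH : ∀ x ∈ interior K, (hessian R x).PosDef)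
  (hKc : Convex ℝ K) (hK : IsCompact K) (hne : (interior K).Nonempty)
  {f : ℕ → EuclideanSpace ℝ (Fin n) →ₗ[ℝ] ℝ} {Ω : Type*} [MeasurableSpace Ω]
  {P : Measure Ω} [IsProbabilityMeasure P]
  {u : ℕ → Ω → UnitSphere n}
  (hu : ∀ t, HasLaw (u t) (sphereUniform n) P) (hind : iIndepFun u P)

include hB hH hKc hK hne hu hind

theorem integrable_loss_and_integral_eq_zero (hn : 1 ≤ n) (w : EuclideanSpace ℝ (Fin n)) (t : ℕ) :
    Integrable (fun ω => f t (action K R η (fun s x => f s x) (fun s => u s ω) t)) P ∧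
    Integrable (fun ω => f t (action K R η (fun s x => f s x) (fun s => u s ω) t) - f t w -
      inner ℝ (grad K R η (fun s x => f s x) (fun s => u s ω) t)
        ((state K R η (fun s x => f s x) (fun s => u s ω) t).1 - w)) P ∧
    ∫ ω, (f t (action K R η (fun s x => f s x) (fun s => u s ω) t) - f t w -
      inner ℝ (grad K R η (fun s x => f s x) (fun s => u s ω) t)
        ((state K R η (fun s x => f s x) (fun s => u s ω) t).1 - w)) ∂P = 0 := by
  have hf : ∀ t, Continuous (f t) := fun t => (f t).continuous_of_finiteDimensional
  -- The first `t` draws are padded with zeros; the padding never affects the state at `t`.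
  set v : ℕ → (Finset.range t → UnitSphere n) →
      EuclideanSpace ℝ (Fin n) := fun s b => if h : s ∈ Finset.range t then b ⟨s, h⟩ else 0
  have hv : ∀ s, Continuous (v s) := fun s => by
    by_cases h : s ∈ Finset.range t
    · simp only [v, h, dif_pos]; fun_prop
    · simp only [v, h, dif_neg, not_false_eq_true]; fun_prop
  set x := fun b => (state K R η (fun s x => f s x) (fun s => v s b) t).1
  have hx : Continuous x :=
    (continuous_state (η := η) hB hH hKc hK hne (f := fun s x => f s x) hf hv t).fst
  have hxK : ∀ b, x b ∈ interior K := fun b => (isIterate_state (η := η) hB hK hne t).1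
  have hxs : ∀ ω, (state K R η (fun s x => f s x) (fun s => u s ω) t).1 =
      x (fun i => u i ω) := fun ω => by
    refine congrArg Prod.fst (state_congr fun s hs => ?_)
    simp [v, hs]
  simp only [grad, action, hxs]
  have h1 : Continuous fun p : (Finset.range t → UnitSphere n) × UnitSphere n =>
      play R (x p.1) p.2 :=
    continuous_play hB hH (hx.comp continuous_fst) (fun p => hxK p.1)
      (continuous_subtype_val.comp continuous_snd)
  have h2 : Continuous fun p : (Finset.range t → UnitSphere n) × UnitSphere n =>
      f t (play R (x p.1) p.2) :=
    (hf t).comp h1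
  have h3 : Continuous fun p : (Finset.range t → UnitSphere n) × UnitSphere n =>
      estimate R (x p.1) p.2 (f t (play R (x p.1) p.2)) :=
    continuous_estimate hB hH (hx.comp continuous_fst) (fun p => hxK p.1)
      (continuous_subtype_val.comp continuous_snd) h2
  have h4 : Continuous fun p : (Finset.range t → UnitSphere n) × UnitSphere n =>
      f t (play R (x p.1) p.2) - f t w -
      inner ℝ (estimate R (x p.1) p.2 (f t (play R (x p.1) p.2))) (x p.1 - w) :=
    (h2.sub continuous_const).sub (h3.inner ((hx.comp continuous_fst).sub continuous_const))
  refine ⟨(integrable_and_integral_comp_prefix hn hu hind t h2).1,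
    (integrable_and_integral_comp_prefix hn hu hind t h4).1,
    (integrable_and_integral_comp_prefix hn hu hind t h4).2 fun b => ?_⟩
  exact integral_loss_sub_inner_estimate hn (hH _ (hxK b)) (f t) w

/-- Subtracting the mean-zero variables `D t` turns the losses into the linearized ones, to which
the pathwise bound applies. -/
theorem sum_integral_loss_sub_le (hn : 1 ≤ n) (hη : 0 < η) (hηn : η * n ≤ 1 / 2) {T : ℕ}
    (hf : ∀ t < T, ∀ x ∈ K, |f t x| ≤ 1) {w : EuclideanSpace ℝ (Fin n)} (hw : w ∈ interior K) :
    (∑ t ∈ Finset.range T,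
      ∫ ω, f t (action K R η (fun s x => f s x) (fun s => u s ω) t) ∂P) -
      ∑ t ∈ Finset.range T, f t w ≤ T * (2 * η * n ^ 2) + (R w - R (start K R)) / η := by
  have key := fun t => integrable_loss_and_integral_eq_zero (η := η) (f := f) hB hH hKc hK hne
    hu hind hn w t
  set D := fun t ω => f t (action K R η (fun s x => f s x) (fun s => u s ω) t) - f t w -
      inner ℝ (grad K R η (fun s x => f s x) (fun s => u s ω) t)
        ((state K R η (fun s x => f s x) (fun s => u s ω) t).1 - w)
  set ℓ := fun t ω => f t (action K R η (fun s x => f s x) (fun s => u s ω) t)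
  have hℓ : ∀ t, Integrable (fun ω => ℓ t ω - f t w) P := fun t =>
    (key t).1.sub (integrable_const _)
  have hI : ∀ t, Integrable (fun ω => ℓ t ω - f t w - D t ω) P := fun t => (hℓ t).sub (key t).2.1
  have h1 : (∑ t ∈ Finset.range T, ∫ ω, ℓ t ω ∂P) - ∑ t ∈ Finset.range T, f t w =
      ∫ ω, ∑ t ∈ Finset.range T, (ℓ t ω - f t w - D t ω) ∂P := by
    rw [integral_finsetSum _ fun t _ => hI t,
      ← Finset.sum_sub_distrib]
    refine Finset.sum_congr rfl fun t _ => ?_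
    rw [integral_sub (hℓ t) (key t).2.1, (key t).2.2,
      integral_sub (key t).1 (integrable_const _)]
    simp [ℓ]
  rw [h1]
  have h2 : ∀ ω, ∑ t ∈ Finset.range T, (ℓ t ω - f t w - D t ω) ≤
      T * (2 * η * n ^ 2) + (R w - R (start K R)) / η := fun ω => by
    have h3 := sum_inner_grad_sub_le (η := η) (f := fun s x => f s x)
      (u := fun s => (u s ω : EuclideanSpace ℝ (Fin n))) hB hH hKc hK hne
      (fun t => by simp) hη hηn hf hw
    refine le_of_eq_of_le (Finset.sum_congr rfl fun t _ => ?_) h3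
    exact sub_sub_cancel _ _
  have h4 := integral_mono (μ := P)
    (integrable_finsetSum (Finset.range T) fun t _ => hI t) (integrable_const _) h2
  rwa [integral_const, probReal_univ, one_smul] at h4

end Scrible

/-! ### Choice of constants and comparator -/

theorem mainTheorem12 (n : ℕ) (hn : 1 ≤ n) (ν : ℝ) (hν : 0 ≤ ν) :
    ∃ c C : ℝ, 0 < c ∧ 0 < C ∧
      ∀ (K : Set (EuclideanSpace ℝ (Fin n))) (R : EuclideanSpace ℝ (Fin n) → ℝ),
        IsCompact K → Convex ℝ K → (interior K).Nonempty →
        IsSelfConcordantBarrier K ν R →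
        (∀ x ∈ interior K, (hessian R x).rank = n) →
        ∀ (T : ℕ), 2 ≤ T →
        ∀ (f : ℕ → EuclideanSpace ℝ (Fin n) →ₗ[ℝ] ℝ),
          (∀ t < T, ∀ x ∈ K, |f t x| ≤ 1) →
        ∀ {Ω : Type*} [MeasurableSpace Ω] (P : Measure Ω) [IsProbabilityMeasure P]
          (u : ℕ → Ω → Metric.sphere (0 : EuclideanSpace ℝ (Fin n)) 1),
          (∀ t, HasLaw (u t) (sphereUniform n) P) → iIndepFun u P →
          let y : ℕ → Ω → EuclideanSpace ℝ (Fin n) := fun t ω =>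
            Scrible.action K R (c / √(T : ℝ)) (fun s x => f s x)
              (fun s => (u s ω : EuclideanSpace ℝ (Fin n))) t
          (∀ t < T, ∀ ω, y t ω ∈ K) ∧
          (∀ t < T, Integrable (fun ω => f t (y t ω)) P) ∧
          expectedRegret P K (fun t x => f t x) y T ≤ C * (√(T : ℝ) * Real.log T) := by
  have hn0 : (0 : ℝ) < n := by exact_mod_cast hn
  -- The value of `c` ensures `η n ≤ 1 / 2`. In `C`, the three summands pay for stability, for the
  -- barrier gap, and for moving the comparator; the first and last use `log T ≥ 1 / 2`.
  refine ⟨1 / (2 * n), 2 * n + 2 * n * (ν + 1) + 4, by positivity, by positivity, ?_⟩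
  intro K R hK hKc hne hB hrank T hT f hf Ω _ P _ u hu hind y
  have hH : ∀ x ∈ interior K, (hessian R x).PosDef := fun x hx =>
    hessian_posDef isOpen_interior hB.convexOn hB.contDiffOn hx (hrank x hx)
  have hT2 : (2 : ℝ) ≤ T := by exact_mod_cast hT
  have hT0 : (0 : ℝ) < T := by linarith
  have hs1 : 1 ≤ √(T : ℝ) := Real.one_le_sqrt.2 (by linarith)
  have hs0 : 0 < √(T : ℝ) := by linarith
  set η := 1 / (2 * (n : ℝ)) / √(T : ℝ) with hηdef
  have hη : 0 < η := by positivity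
  have hηn : η * n ≤ 1 / 2 := by
    rw [hηdef, div_mul_eq_mul_div, div_le_iff₀ hs0]
    field_simp; exact hs1
  -- The comparator `0` is a dummy: integrability of the loss does not involve it.
  refine ⟨fun t _ ω => Scrible.action_mem hB hH hK hne (fun s => by simp) t, fun t _ =>
    (Scrible.integrable_loss_and_integral_eq_zero hB hH hKc hK hne hu hind hn 0 t).1, ?_⟩
  have hlog : 1 / 2 ≤ Real.log T := by
    have := Real.log_le_log (by norm_num) hT2
    linarith [Real.log_two_gt_d9]
  have hx₁ := (Scrible.isIterate_start hB hK hne η).1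
  set x₁ := Scrible.start K R
  set A := ∑ t ∈ Finset.range T, ∫ ω, f t (y t ω) ∂P
  have hint : ∀ z ∈ interior K, A - (2 * n + 2 * n * (ν + 1) + 4) * (√(T : ℝ) * Real.log T) ≤
      ∑ t ∈ Finset.range T, f t z := by
    intro z hz
    have hδ1 : (T : ℝ)⁻¹ ≤ 1 := inv_le_one_of_one_le₀ (by linarith)
    have hw : x₁ + (1 - (T : ℝ)⁻¹) • (z - x₁) ∈ interior K :=
      hKc.interior.add_smul_sub_mem hx₁ hz ⟨by linarith, by linarith [inv_pos.2 hT0]⟩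
    have h1 := Scrible.sum_integral_loss_sub_le hB hH hKc hK hne hu hind hn hη hηn hf hw
    have h2 := Scrible.barrier_sub_le hB hν hKc hx₁ hz (inv_pos.2 hT0) hδ1
    rw [inv_inv] at h2
    -- Losses differ by at most 2 on `K`, so the shift costs at most `2 / T` per round.
    have h3 : ∑ t ∈ Finset.range T, f t (x₁ + (1 - (T : ℝ)⁻¹) • (z - x₁)) ≤
        ∑ t ∈ Finset.range T, f t z + 2 := by
      have h4 : ∀ t ∈ Finset.range T, f t (x₁ + (1 - (T : ℝ)⁻¹) • (z - x₁)) ≤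
          f t z + 2 * (T : ℝ)⁻¹ := fun t ht => by
        have ht := Finset.mem_range.1 ht
        have h5 := abs_le.1 (hf t ht x₁ (interior_subset hx₁))
        have h6 := abs_le.1 (hf t ht z (interior_subset hz))
        have h7 : f t (x₁ + (1 - (T : ℝ)⁻¹) • (z - x₁)) =
            f t z + (f t x₁ - f t z) * (T : ℝ)⁻¹ := by
          rw [map_add, map_smul, map_sub, smul_eq_mul]; ring
        rw [h7]
        have := mul_le_mul_of_nonneg_right (by linarith : f t x₁ - f t z ≤ 2)
          (inv_pos.2 hT0).le
        linarith
      refine (Finset.sum_le_sum h4).trans_eq ?_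
      rw [Finset.sum_add_distrib, Finset.sum_const, Finset.card_range, nsmul_eq_mul]
      field_simp
    have h5 : (T : ℝ) * (2 * η * n ^ 2) = n * √(T : ℝ) := by
      rw [hηdef]
      field_simp
      rw [Real.sq_sqrt hT0.le]
    have h6 : (R (x₁ + (1 - (T : ℝ)⁻¹) • (z - x₁)) - R x₁) / η ≤
        2 * n * (ν + 1) * (√(T : ℝ) * Real.log T) := by
      rw [div_le_iff₀ hη]
      refine h2.trans_eq ?_
      rw [hηdef]
      field_simp
    have h7 : (n : ℝ) * √(T : ℝ) ≤ 2 * n * (√(T : ℝ) * Real.log T) := by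
      have := mul_le_mul_of_nonneg_left hlog (by positivity : 0 ≤ 2 * n * √(T : ℝ))
      linarith
    have h8 : 2 ≤ 4 * (√(T : ℝ) * Real.log T) := by
      have := mul_le_mul hs1 hlog (by norm_num) hs0.le
      linarith
    rw [h5] at h1
    have h9 : A - ∑ t ∈ Finset.range T, f t (x₁ + (1 - (T : ℝ)⁻¹) • (z - x₁)) ≤ _ := h1
    linarith
  rw [expectedRegret, sub_le_comm]
  refine le_csInf ((hne.mono interior_subset).image _) ?_
  rintro _ ⟨z, hz, rfl⟩
  -- The bound holds on the interior, which is dense in `K`, and is a closed condition on `z`.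
  have hcl : z ∈ closure (interior K) := by
    rw [hKc.closure_interior_eq_closure_of_nonempty_interior hne]
    exact subset_closure hz
  have hcont : Continuous fun z => ∑ t ∈ Finset.range T, f t z :=
    continuous_finsetSum _ fun t _ => (f t).continuous_of_finiteDimensional
  exact closure_minimal hint (isClosed_le continuous_const hcont) hcl
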